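/- Let $G$ be a compact Polish group with Haar probability measure $m_G$, and let $\Gamma,\Lambda<G$ be countable dense subgroups. Consider the left-right translation action $\Gamma\times\Lambda\curvearrowright (G,m_G)$ given by $(g,h)\cdot x=gxh^{-1}$. Assume that $\Lambda$ is finitely generated and that the left translation action of $\Gamma$ on $(G,m_G)$ is strongly ergodic, i.e. every sequence of measurable sets $A_n\subseteq G$ with $m_G(gA_n\,\triangle\, A_n)\to 0$ for all $g\in\Gamma$ satisfies $m_G(A_n)(1-m_G(A_n))\to 0$. For an action of a countable group $S$ on a measure space $(X,\mu)$ and a countable group $\Delta$, a cocycle is a measurable map $w:S\times X\to\Delta$ with $w(g_1g_2,x)=w(g_1,g_2x)w(g_2,x)$ for all $g_1,g_2\in S$ and almost every $x\in X$. It is cohomologous to a homomorphism $\delta:S\to\Delta$ if there is a measurable map $\varphi:X\to\Delta$ with $w(g,x)=\varphi(gx)\delta(g)\varphi(x)^{-1}$ for all $g\in S$ and almost every $x\in X$. Let $w:(\Gamma\times\Lambda)\times G\to\Delta$ be a cocycle with values in a countable group $\Delta$. Then the following hold. (1) Assume that $G$ is profinite and $\Gamma$ is finitely generated. Then there is an open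 subgroup $G_0<G$ such that, with $\Gamma_0=\Gamma\cap G_0$ and $\Lambda_0=\Lambda\cap G_0$, the restriction of $w$ to $(\Gamma_0\times\Lambda_0)\times G_0$ is cohomologous to a homomorphism $\delta:\Gamma_0\times\Lambda_0\to\Delta$. (2) Assume that $G$ is connected, and let $\tilde G$ be a simply connected (Hausdorff) locally compact group together with a continuous surjective homomorphism $p:\tilde G\to G$ with discrete kernel. Put $\tilde\Gamma=p^{-1}(\Gamma)$ and $\tilde\Lambda=p^{-1}(\Lambda)$, acting on $\tilde G$ (with its Haar measure) by left-right translations. Then the lifted cocycle $\tilde w:(\tilde\Gamma\times\tilde\Lambda)\times\tilde G\to\Delta$, $\tilde w((g,h),x)=w((p(g),p(h)),p(x))$, is cohomologous to a homomorphism $\delta:\tilde\Gamma\times\tilde\Lambda\to\Delta$. -/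

import Mathlib

open MeasureTheory Filter Topology

/-- Strong ergodicity of an action on a probability space: every asymptotically invariant
sequence of measurable sets is asymptotically trivial. -/
def StronglyErgodic (S : Type*) {X : Type*} [Group S] [MulAction S X] [MeasurableSpace X]
    (μ : Measure X) [IsProbabilityMeasure μ] : Prop :=
  ∀ A : ℕ → Set X, (∀ n, MeasurableSet (A n)) →
    (∀ g : S, Tendsto (fun n => μ.real (symmDiff ((fun x => g • x) '' A n) (A n)))
      atTop (𝓝 0)) →
    Tendsto (fun n => μ.real (A n) * (1 - μ.real (A n))) atTop (𝓝 0)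

/-- A measurable cocycle `w : S × X → Δ` for an action of a countable group `S` on `(X, μ)`.
As `S` is countable and discrete, measurability on `S × X` is measurability of each `w g`. -/
structure IsMeasurableCocycle {S X Δ : Type*} [Group S] [MulAction S X] [MeasurableSpace X]
    (μ : Measure X) [Group Δ] [MeasurableSpace Δ] (w : S → X → Δ) : Prop where
  measurable : ∀ g : S, Measurable (w g)
  map_mul : ∀ g₁ g₂ : S, ∀ᵐ x ∂μ, w (g₁ * g₂) x = w g₁ (g₂ • x) * w g₂ x

/-- `w₁` and `w₂` are cohomologous: `w₁ (g, x) = φ (g x) w₂ (g, x) φ (x)⁻¹` for some measurable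
`φ`, all `g` and almost every `x`. -/
def AreCohomologous {S X Δ : Type*} [Group S] [MulAction S X] [MeasurableSpace X]
    (μ : Measure X) [Group Δ] [MeasurableSpace Δ] (w₁ w₂ : S → X → Δ) : Prop :=
  ∃ φ : X → Δ, Measurable φ ∧
    ∀ g : S, ∀ᵐ x ∂μ, w₁ g x = φ (g • x) * w₂ g x * (φ x)⁻¹

/-- `w` is cohomologous to a homomorphism, viewed as a constant cocycle. -/
def CohomologousToHom {S X Δ : Type*} [Group S] [MulAction S X] [MeasurableSpace X]
    (μ : Measure X) [Group Δ] [MeasurableSpace Δ] (w : S → X → Δ) : Prop :=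
  ∃ δ : S →* Δ, AreCohomologous μ w (fun g _ => δ g)

/-- The left-right translation action of `Γ × Λ` on `G`: `(g, h) • x = g x h⁻¹`. -/
instance leftRightAction {G : Type*} [Group G] (Γ Λ : Subgroup G) : MulAction (Γ × Λ) G where
  smul k x := (k.1 : G) * x * (k.2 : G)⁻¹
  one_smul x := by
    change ((1 : Γ) : G) * x * ((1 : Λ) : G)⁻¹ = x
    simp
  mul_smul a b x := by
    change ((a.1 * b.1 : Γ) : G) * x * ((a.2 * b.2 : Λ) : G)⁻¹
      = (a.1 : G) * ((b.1 : G) * x * (b.2 : G)⁻¹) * (a.2 : G)⁻¹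
    simp [mul_assoc]

/-- The restriction of `w : (Γ × Λ) × G → Δ` to `(Γ₀ × Λ₀) × G₀`, where `Γ₀ = Γ ∩ G₀` and
`Λ₀ = Λ ∩ G₀`, regarded as subgroups of `G₀`. -/
def restrictCocycle {G Δ : Type*} [Group G] {Γ Λ : Subgroup G} (w : Γ × Λ → G → Δ)
    (G₀ : Subgroup G) : Γ.subgroupOf G₀ × Λ.subgroupOf G₀ → G₀ → Δ :=
  fun k x => w (⟨((k.1 : G₀) : G), Subgroup.mem_subgroupOf.1 k.1.2⟩,
    ⟨((k.2 : G₀) : G), Subgroup.mem_subgroupOf.1 k.2.2⟩) (x : G)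

/-- The lift of `w : (Γ × Λ) × G → Δ` along `p : H → G`: the map on `(p⁻¹(Γ) × p⁻¹(Λ)) × H`
given by `((g, h), x) ↦ w ((p g, p h), p x)`. -/
def liftCocycle {G H Δ : Type*} [Group G] [Group H] {Γ Λ : Subgroup G} (w : Γ × Λ → G → Δ)
    (p : H →* G) : Γ.comap p × Λ.comap p → H → Δ :=
  fun k x => w (⟨p (k.1 : H), Subgroup.mem_comap.1 k.1.2⟩,
    ⟨p (k.2 : H), Subgroup.mem_comap.1 k.2.2⟩) (p x)

/-!
Write `v g = w (g, 1)` and `φ k = w (1, k)` for the two halves of the cocycle. They satisfy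
`v g (x k⁻¹) φ k x = φ k (g x) v g x`, so `v g` conjugates the right cocycle `φ` to its translate by
`g`. An *intertwiner* over an arbitrary `s ∈ G` is a measurable `ψ` with
`ψ (x k⁻¹) φ k x = φ k (s x) ψ x` for all `k ∈ Λ`. The proof finds intertwiners close to `1` over
all `s` close to `1`.

* By the identity above the set `{φ k (x t) = φ k x}` is almost `Γ`-invariant for `t` small,
  uniformly in `k`; strong ergodicity makes it almost null or almost conull, and induction on word
  length in the finitely generated group `Λ` excludes the first alternative. So all `φ k` are
  uniformly almost invariant under right translation by small elements
  (`exists_nhds_uniformly_close`), and, averaging over a conjugation invariant neighbourhood `V` of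
  `1`, each of them also under left translation by most elements of `V`.
* Hence the constant field `1` is almost invariant under the skew product action on `V × G × Δ` that
  combines `φ k` with its translates, and a convexity argument in `L²` gives a nearby invariant set.
  By ergodicity its fibres are singletons, that is, it is a field of intertwiners, over a set of
  positive measure (`exists_measurableSet_subset_nearTrivial`). By Steinhaus' theorem they exist
  over a whole neighbourhood of `1` (`nearTrivial_mem_nhds`).
* By ergodicity of the dense subgroup `Λ` an intertwiner close to `1` is unique, so these canonical
  intertwiners form a local homomorphism `s ↦ (s, ψ)`, equivariant under conjugation by `(g, v g)`.
  In the profinite case it restricts to a homomorphism of a small open normal subgroup, equivariant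
  under the finitely many generators of `Γ` (`exists_open_subgroup_cohomologousToHom`). In the
  connected case it extends to the simply connected cover by monodromy
  (`exists_monoidHom_eventuallyEq`); equivariance propagates from small elements because the cover
  is connected (`cohomologousToHom_of_simplyConnected`). Monodromy needs local path connectedness,
  which for a path connected second countable locally compact group follows from Baire's theorem
  (`locallyPathConnectedSpace_of_pathConnected`).
* Such a homomorphism is a cocycle `F` for the left translation action. Pulled back to the group it
  is the coboundary of a map `ψ`, and conjugating `w` by `ψ` gives a cocycle that is invariant under
  all left translations, hence a homomorphism (`cohomologousToHom_of_equivariant`).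
-/

/-! ### Strong ergodicity and continuity of translations in measure -/

/-- Quantitative form of strong ergodicity: a set that is almost invariant under a suitable finite
set of group elements is almost null or almost conull. -/
theorem StronglyErgodic.exists_finset {S X : Type*} [Group S] [Countable S] [MulAction S X]
    [MeasurableSpace X] {μ : Measure X} [IsProbabilityMeasure μ] (h : StronglyErgodic S μ)
    {ε : ℝ} (hε : 0 < ε) :
    ∃ F : Finset S, ∃ δ > 0, ∀ A : Set X, MeasurableSet A →
      (∀ g ∈ F, μ.real (symmDiff ((fun x => g • x) '' A) A) ≤ δ) →
      μ.real A < ε ∨ 1 - ε < μ.real A := by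
  by_contra! hcon
  obtain ⟨e, he⟩ := exists_surjective_nat S
  classical
  choose A hA hAinv hA1 hA2 using fun n : ℕ =>
    hcon ((Finset.range (n + 1)).image e) (1 / ((n : ℝ) + 1)) (by positivity)
  have key := h A hA fun g => by
    obtain ⟨m, rfl⟩ := he g
    refine squeeze_zero' (Eventually.of_forall fun n => measureReal_nonneg) ?_
      tendsto_one_div_add_atTop_nhds_zero_nat
    filter_upwards [eventually_ge_atTop m] with n hn
    exact hAinv n _ (Finset.mem_image_of_mem _ (Finset.mem_range.2 (by omega)))
  have hlow : ∀ n, ε * ε ≤ μ.real (A n) * (1 - μ.real (A n)) := fun n =>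
    mul_le_mul (hA1 n) (by linarith [hA2 n]) hε.le measureReal_nonneg
  exact absurd (ge_of_tendsto' key hlow) (not_le.2 (mul_pos hε hε))

/-- Haar measure of a compact group is right invariant. -/
theorem isMulRightInvariant_of_compactSpace {G : Type*} [Group G] [TopologicalSpace G]
    [IsTopologicalGroup G] [CompactSpace G] [MeasurableSpace G] [BorelSpace G]
    (μ : Measure G) [μ.IsHaarMeasure] [IsProbabilityMeasure μ] : μ.IsMulRightInvariant where
  map_mul_right_eq_self g := by
    have : IsProbabilityMeasure (μ.map (· * g)) :=
      Measure.isProbabilityMeasure_map (measurable_mul_const g).aemeasurable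
    exact Measure.isHaarMeasure_eq_of_isProbabilityMeasure _ _

/-- In a compact group every neighbourhood of `1` contains one that is invariant under
conjugation. -/
theorem exists_isOpen_conj_invariant {G : Type*} [Group G] [TopologicalSpace G]
    [IsTopologicalGroup G] [CompactSpace G] {U : Set G} (hU : U ∈ 𝓝 (1 : G)) :
    ∃ V : Set G, IsOpen V ∧ (1 : G) ∈ V ∧ V ⊆ U ∧ ∀ g, ∀ t ∈ V, g * t * g⁻¹ ∈ V := by
  obtain ⟨O, hOU, hO, h1O⟩ := mem_nhds_iff.1 hU
  refine ⟨{t | ∀ g : G, g * t * g⁻¹ ∈ O}, ?_, by simpa, fun t ht => hOU (by simpa using ht 1),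
    fun g t ht k => by simpa [mul_assoc] using ht (k * g)⟩
  rw [isOpen_iff_mem_nhds]
  intro t ht
  have := isCompact_univ.eventually_forall_of_forall_eventually (x₀ := t)
    (P := fun (t g : G) => g * t * g⁻¹ ∈ O) fun g _ => by
      have hc : Continuous fun z : G × G => z.2 * z.1 * z.2⁻¹ := by fun_prop
      exact hc.continuousAt.eventually (hO.mem_nhds (ht g))
  filter_upwards [this] with s hs g using hs g trivial

/-- If measure preserving maps `a i` converge to the identity, then `f ∘ a i` converges to `f` in
measure, for every measurable map `f` into a countable discrete space. -/
theorem tendsto_measureReal_comp_ne {X Δ ι : Type*} [TopologicalSpace X] [R1Space X]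
    [MeasurableSpace X] [BorelSpace X] {μ : Measure X} [IsFiniteMeasure μ] [μ.InnerRegular]
    [Countable Δ] [MeasurableSpace Δ] [DiscreteMeasurableSpace Δ] {l : Filter ι}
    {a : ι → C(X, X)} (ha : Tendsto a l (𝓝 (ContinuousMap.id X)))
    (hmp : ∀ i, MeasurePreserving (a i) μ μ) {f : X → Δ} (hf : Measurable f) {ε : ℝ}
    (hε : 0 < ε) : ∀ᶠ i in l, μ.real {x | f (a i x) ≠ f x} < ε := by
  -- outside a finite set of values, `f` is negligible
  obtain ⟨D, hD⟩ : ∃ D : Finset Δ, μ.real (f ⁻¹' (D : Set Δ)ᶜ) < ε / 2 := by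
    have hanti : Antitone fun D : Finset Δ => f ⁻¹' (D : Set Δ)ᶜ := fun D D' h =>
      Set.preimage_mono (Set.compl_subset_compl.2 (by exact_mod_cast h))
    have h := tendsto_measure_iInter_atTop (μ := μ)
      (fun D : Finset Δ => (hf (Set.to_countable _).measurableSet).nullMeasurableSet) hanti
      ⟨∅, measure_ne_top _ _⟩
    have h0 : ⋂ D : Finset Δ, f ⁻¹' (D : Set Δ)ᶜ = ∅ := by
      ext x
      simp only [Set.mem_iInter, Set.mem_empty_iff_false, iff_false, not_forall]
      exact ⟨{f x}, by simp⟩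
    rw [h0, measure_empty] at h
    have h' := (ENNReal.tendsto_toReal ENNReal.zero_ne_top).comp h
    obtain ⟨D, hD⟩ := (h'.eventually
      (gt_mem_nhds (show (0 : ENNReal).toReal < ε / 2 by simpa using hε))).exists
    exact ⟨D, hD⟩
  have hlev : ∀ d : Δ, Tendsto (fun i => μ.real (symmDiff (a i ⁻¹' (f ⁻¹' {d})) (f ⁻¹' {d})))
      l (𝓝 0) := fun d => by
    have h := tendsto_measure_symmDiff_preimage_nhds_zero ha (Eventually.of_forall hmp)
      (MeasurePreserving.id μ) (hf (measurableSet_singleton d)).nullMeasurableSet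
      (measure_ne_top _ _)
    exact (ENNReal.tendsto_toReal ENNReal.zero_ne_top).comp h
  have hsum := tendsto_finsetSum D fun d _ => hlev d
  rw [Finset.sum_const_zero] at hsum
  filter_upwards [hsum.eventually (gt_mem_nhds (half_pos hε))] with i hi
  have hsub : {x | f (a i x) ≠ f x} ⊆ f ⁻¹' (D : Set Δ)ᶜ ∪
      ⋃ d ∈ D, symmDiff (a i ⁻¹' (f ⁻¹' {d})) (f ⁻¹' {d}) := by
    intro x hx
    by_cases h : f x ∈ D
    · exact Or.inr (Set.mem_biUnion h (Or.inr ⟨rfl, hx⟩))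
    · exact Or.inl h
  calc μ.real {x | f (a i x) ≠ f x} ≤ _ := measureReal_mono hsub
    _ ≤ _ := measureReal_union_le _ _
    _ ≤ μ.real (f ⁻¹' (D : Set Δ)ᶜ) +
        ∑ d ∈ D, μ.real (symmDiff (a i ⁻¹' (f ⁻¹' {d})) (f ⁻¹' {d})) :=
      add_le_add le_rfl (measureReal_biUnion_finset_le _ _)
    _ < ε := by linarith

section Translation

variable {G Δ : Type*} [Group G] [TopologicalSpace G] [IsTopologicalGroup G]
  [R1Space G] [MeasurableSpace G] [BorelSpace G] {μ : Measure G} [IsFiniteMeasure μ]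
  [μ.InnerRegular] [Countable Δ] [MeasurableSpace Δ] [DiscreteMeasurableSpace Δ]

theorem eventually_measureReal_mul_right_ne [μ.IsMulRightInvariant] {f : G → Δ}
    (hf : Measurable f) {ε : ℝ} (hε : 0 < ε) :
    ∀ᶠ t in 𝓝 (1 : G), μ.real {x | f (x * t) ≠ f x} < ε := by
  let a : C(G, C(G, G)) := ContinuousMap.curry ⟨fun z : G × G => z.2 * z.1, by fun_prop⟩
  have ha : Tendsto a (𝓝 1) (𝓝 (ContinuousMap.id G)) := by
    have h := a.continuous.tendsto 1
    have h1 : a 1 = ContinuousMap.id G := by ext x; simp [a]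
    rwa [h1] at h
  exact tendsto_measureReal_comp_ne ha (fun t => measurePreserving_mul_right μ t) hf hε

theorem eventually_measureReal_mul_left_ne [μ.IsMulLeftInvariant] {f : G → Δ}
    (hf : Measurable f) {ε : ℝ} (hε : 0 < ε) :
    ∀ᶠ s in 𝓝 (1 : G), μ.real {x | f (s * x) ≠ f x} < ε := by
  let a : C(G, C(G, G)) := ContinuousMap.curry ⟨fun z : G × G => z.1 * z.2, by fun_prop⟩
  have ha : Tendsto a (𝓝 1) (𝓝 (ContinuousMap.id G)) := by
    have h := a.continuous.tendsto 1
    have h1 : a 1 = ContinuousMap.id G := by ext x; simp [a]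
    rwa [h1] at h
  exact tendsto_measureReal_comp_ne ha (fun s => measurePreserving_mul_left μ s) hf hε

end Translation

/-- A set that is invariant under right translation by a dense subgroup is null or conull. -/
theorem ae_or_ae_not_of_mul_right_invariant {G : Type*} [Group G] [TopologicalSpace G]
    [IsTopologicalGroup G] [SecondCountableTopology G] [MeasurableSpace G] [BorelSpace G]
    {μ : Measure G} [IsFiniteMeasure μ] [μ.InnerRegular] [μ.IsMulRightInvariant]
    {Λ : Subgroup G} (hΛ : Dense (Λ : Set G)) {P : G → Prop} (hP : MeasurableSet {x | P x})
    (hinv : ∀ k ∈ Λ, ∀ᵐ x ∂μ, P (x * k) ↔ P x) : (∀ᵐ x ∂μ, P x) ∨ ∀ᵐ x ∂μ, ¬ P x := by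
  have hd : Dense {g : Gᵐᵒᵖ | (g • ·) ⁻¹' {x | P x} =ᵐ[μ] {x | P x}} := by
    refine (hΛ.preimage (MulOpposite.opHomeomorph (M := G)).symm.isOpenMap).mono ?_
    intro g hg
    filter_upwards [hinv _ hg] with x hx
    exact propext hx
  have h := aeconst_of_dense_setOfPred_preimage_smul_ae hP.nullMeasurableSet hd
  rcases eventuallyConst_set.1 h with h | h
  · exact Or.inl h
  · refine Or.inr ?_
    filter_upwards [h] with x hx using fun hPx => hx hPx

/-! ### Invariant sets close to a given almost invariant set -/

/-- The element of minimal norm in the closed convex hull of a set that is stable under a family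
of linear isometries is fixed by all of them. -/
theorem exists_fixed_mem_closure_convexHull {E κ : Type*} [NormedAddCommGroup E]
    [InnerProductSpace ℝ E] [CompleteSpace E] (U : κ → E →ₗᵢ[ℝ] E) {O : Set E}
    (hO : O.Nonempty) (hU : ∀ j, Set.MapsTo (U j) O O) :
    ∃ η ∈ closure (convexHull ℝ O), ∀ j, U j η = η := by
  have hconv : Convex ℝ (closure (convexHull ℝ O)) := (convex_convexHull ℝ O).closure
  obtain ⟨η, hη, hmin⟩ := exists_norm_eq_iInf_of_complete_convex
    (hO.mono (subset_convexHull ℝ O |>.trans subset_closure)) isClosed_closure.isComplete hconv 0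
  rw [norm_eq_iInf_iff_real_inner_le_zero hconv hη] at hmin
  refine ⟨η, hη, fun j => ?_⟩
  have hmaps : U j η ∈ closure (convexHull ℝ O) := by
    have h1 := image_closure_subset_closure_image (U j).continuous (Set.mem_image_of_mem _ hη)
    have h2 : (U j) '' convexHull ℝ O ⊆ convexHull ℝ O := by
      rw [← LinearIsometry.coe_toLinearMap, LinearMap.image_convexHull]
      exact convexHull_mono (hU j).image_subset
    exact closure_mono h2 h1
  have h3 := hmin _ hmaps
  rw [zero_sub, inner_neg_left, inner_sub_right, real_inner_self_eq_norm_sq] at h3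
  have h4 : ‖U j η - η‖ ^ 2 ≤ 0 := by
    rw [norm_sub_sq_real, LinearIsometry.norm_map, real_inner_comm]
    linarith
  exact sub_eq_zero.1 (norm_eq_zero.1 (by nlinarith [norm_nonneg (U j η - η)]))

/-- If the translates `T k ⁻¹' A` of a set `A` of finite measure under measure preserving maps
are permuted by the maps, up to null sets, and are uniformly close to `A`, then there is an
invariant set close to `A`. -/
theorem exists_invariant_set_near {X κ : Type*} [Nonempty κ] [MeasurableSpace X] {μ : Measure X}
    {T : κ → X → X} (hT : ∀ k, MeasurePreserving (T k) μ μ) {A : Set X} (hA : MeasurableSet A)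
    (hAfin : μ A ≠ ⊤) (hperm : ∀ j k, ∃ l, T j ⁻¹' (T k ⁻¹' A) =ᵐ[μ] T l ⁻¹' A)
    {ε : ℝ} (hε : 0 ≤ ε) (hclose : ∀ k, μ.real (symmDiff (T k ⁻¹' A) A) ≤ ε) :
    ∃ B, MeasurableSet B ∧ (∀ k, T k ⁻¹' B =ᵐ[μ] B) ∧
      μ (symmDiff B A) ≤ ENNReal.ofReal (4 * ε) := by
  have hfin : ∀ k, μ (T k ⁻¹' A) ≠ ⊤ := fun k => by
    rwa [(hT k).measure_preimage hA.nullMeasurableSet]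
  let f : κ → Lp ℝ 2 μ := fun k => indicatorConstLp 2 ((hT k).measurable hA) (hfin k) 1
  let f₀ : Lp ℝ 2 μ := indicatorConstLp 2 hA hAfin 1
  let U : κ → Lp ℝ 2 μ →ₗᵢ[ℝ] Lp ℝ 2 μ := fun k => Lp.compMeasurePreservingₗᵢ ℝ (T k) (hT k)
  have hU : ∀ k (g : Lp ℝ 2 μ), (U k g : X → ℝ) =ᵐ[μ] g ∘ T k := fun k g =>
    Lp.coeFn_compMeasurePreserving g (hT k)
  have hmaps : ∀ j, Set.MapsTo (U j) (Set.range f) (Set.range f) := by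
    rintro j _ ⟨k, rfl⟩
    obtain ⟨l, hl⟩ := hperm j k
    refine ⟨l, ?_⟩
    apply Lp.ext
    have h1 : (f l : X → ℝ) =ᵐ[μ] (T l ⁻¹' A).indicator fun _ => (1 : ℝ) := indicatorConstLp_coeFn
    have h2 : (f k : X → ℝ) =ᵐ[μ] (T k ⁻¹' A).indicator fun _ => (1 : ℝ) := indicatorConstLp_coeFn
    have h3 := (hT j).quasiMeasurePreserving.ae h2
    filter_upwards [h1, h3, hU j (f k), hl] with x hx1 hx3 hx4 hx5
    rw [hx1, hx4, Function.comp_apply, hx3]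
    have hx6 : T j x ∈ T k ⁻¹' A ↔ x ∈ T l ⁻¹' A := iff_of_eq hx5
    by_cases h : x ∈ T l ⁻¹' A
    · rw [Set.indicator_of_mem h, Set.indicator_of_mem (hx6.2 h)]
    · rw [Set.indicator_of_notMem h, Set.indicator_of_notMem (fun h' => h (hx6.1 h'))]
  obtain ⟨η, hη, hfix⟩ := exists_fixed_mem_closure_convexHull U (Set.range_nonempty f) hmaps
  have hdist : ‖η - f₀‖ ≤ Real.sqrt ε := by
    have hsub : closure (convexHull ℝ (Set.range f)) ⊆ Metric.closedBall f₀ (Real.sqrt ε) := by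
      refine closure_minimal (convexHull_min ?_ (convex_closedBall _ _)) Metric.isClosed_closedBall
      rintro _ ⟨k, rfl⟩
      rw [Metric.mem_closedBall, dist_indicatorConstLp_eq_norm, norm_indicatorConstLp
        (by norm_num) (by norm_num)]
      simp only [norm_one, one_mul, ENNReal.toReal_ofNat]
      rw [← Real.sqrt_eq_rpow]
      exact Real.sqrt_le_sqrt (hclose k)
    simpa [dist_eq_norm] using hsub hη
  refine ⟨{x | 1 / 2 < η x}, measurableSet_lt measurable_const (Lp.stronglyMeasurable η).measurable,
    fun k => ?_, ?_⟩
  · have h1 := hU k η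
    rw [hfix k] at h1
    filter_upwards [h1] with x hx
    refine propext ?_
    change (1 / 2 < η (T k x)) ↔ (1 / 2 < η x)
    rw [hx, Function.comp_apply]
  · have h1 := Lp.meas_ge_le_mul_pow_enorm (η - f₀) (by norm_num) (by norm_num)
      (ε := 1 / 2) (by norm_num)
    have h2 : ((1 / 2 : ENNReal)⁻¹) ^ (2 : ENNReal).toReal * ENNReal.ofReal ‖η - f₀‖ ^
        (2 : ENNReal).toReal ≤ ENNReal.ofReal (4 * ε) := by
      have h3 : (1 / 2 : ENNReal)⁻¹ = ENNReal.ofReal 2 := by simp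
      have h4 : ‖η - f₀‖ ^ 2 ≤ ε := by
        calc ‖η - f₀‖ ^ 2 ≤ Real.sqrt ε ^ 2 := by gcongr
          _ = ε := Real.sq_sqrt hε
      rw [h3]
      simp only [ENNReal.toReal_ofNat, ENNReal.rpow_ofNat]
      rw [← ENNReal.ofReal_pow (by norm_num), ← ENNReal.ofReal_pow (norm_nonneg _),
        ← ENNReal.ofReal_mul (by norm_num)]
      exact ENNReal.ofReal_le_ofReal (by linarith)
    refine le_trans (measure_mono_ae ?_) (h1.trans h2)
    have h5 : (f₀ : X → ℝ) =ᵐ[μ] A.indicator fun _ => (1 : ℝ) := indicatorConstLp_coeFn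
    filter_upwards [h5, Lp.coeFn_sub η f₀] with x hx5 hx6 hx
    have h7 : (1 / 2 : ℝ) ≤ ‖(η - f₀ : Lp ℝ 2 μ) x‖ := by
      rw [hx6, Pi.sub_apply, hx5, Real.norm_eq_abs]
      rcases hx with ⟨hx, hxA⟩ | ⟨hxA, hx⟩
      · rw [Set.indicator_of_notMem hxA, sub_zero]
        exact (show 1 / 2 < η x from hx).le.trans (le_abs_self _)
      · rw [Set.indicator_of_mem hxA, abs_sub_comm]
        have : η x ≤ 1 / 2 := not_lt.1 hx
        exact le_trans (by linarith) (le_abs_self _)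
    change (1 / 2 : ENNReal) ≤ ‖(η - f₀ : Lp ℝ 2 μ) x‖ₑ
    have h8 := ENNReal.ofReal_le_ofReal h7
    rw [ofReal_norm] at h8
    simpa using h8

/-! ### Almost right-invariance of the right cocycle -/

section
variable {G : Type*} [MeasurableSpace G] {μ : Measure G}

theorem measureReal_setOf_le_add [IsFiniteMeasure μ] {p q r : G → Prop}
    (h : ∀ᵐ x ∂μ, p x → q x ∨ r x) :
    μ.real {x | p x} ≤ μ.real {x | q x} + μ.real {x | r x} := by
  refine le_trans ?_ (measureReal_union_le _ _)
  exact ENNReal.toReal_mono (measure_ne_top _ _) (measure_mono_ae h)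

variable [Group G] [MeasurableMul G]

theorem measureReal_mul_right [μ.IsMulRightInvariant] (p : G → Prop) (t : G) :
    μ.real {x | p (x * t)} = μ.real {x | p x} :=
  congrArg ENNReal.toReal (measure_preimage_mul_right μ t {x | p x})

theorem measureReal_mul_left [μ.IsMulLeftInvariant] (p : G → Prop) (t : G) :
    μ.real {x | p (t * x)} = μ.real {x | p x} :=
  congrArg ENNReal.toReal (measure_preimage_mul μ t {x | p x})

end

theorem ae_mul_right {G : Type*} [MeasurableSpace G] {μ : Measure G} [Group G] [MeasurableMul G]
    [μ.IsMulRightInvariant] {p : G → Prop} (h : ∀ᵐ x ∂μ, p x) (t : G) : ∀ᵐ x ∂μ, p (x * t) :=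
  (measurePreserving_mul_right μ t).quasiMeasurePreserving.ae h

theorem ae_mul_left {G : Type*} [MeasurableSpace G] {μ : Measure G} [Group G] [MeasurableMul G]
    [μ.IsMulLeftInvariant] {p : G → Prop} (h : ∀ᵐ x ∂μ, p x) (t : G) : ∀ᵐ x ∂μ, p (t * x) :=
  (measurePreserving_mul_left μ t).quasiMeasurePreserving.ae h

theorem measurableSet_eq_of_discrete {X Δ : Type*} [MeasurableSpace X] [Countable Δ]
    [MeasurableSpace Δ] [DiscreteMeasurableSpace Δ] {f f' : X → Δ} (hf : Measurable f)
    (hf' : Measurable f') : MeasurableSet {x | f x = f' x} :=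
  (hf.prodMk hf') (Set.to_countable {z : Δ × Δ | z.1 = z.2}).measurableSet

section Uniform

variable {G : Type*} [Group G] [TopologicalSpace G] [IsTopologicalGroup G]
  [CompactSpace G] [PolishSpace G] [MeasurableSpace G] [BorelSpace G]
  {μ : Measure G} [μ.IsHaarMeasure] [IsProbabilityMeasure μ] [μ.IsMulRightInvariant]
  {Γ Λ : Subgroup G} [Countable Γ]
  {Δ : Type*} [Group Δ] [Countable Δ] [MeasurableSpace Δ] [DiscreteMeasurableSpace Δ]
  {v : Γ → G → Δ} {φ : Λ → G → Δ}

omit [CompactSpace G] in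
/-- Strong ergodicity of `Γ` forces the set where `φ k` is unchanged by a right translation
by a small element to be almost null or almost conull, uniformly in `k`: the transfer relation
between `φ` and `v` makes this set almost `Γ`-invariant. -/
theorem exists_nhds_almost_null_or_conull (hΓ : StronglyErgodic Γ μ) (hv : ∀ g, Measurable (v g))
    (hφ : ∀ k, Measurable (φ k))
    (hvφ : ∀ (g : Γ) (k : Λ), ∀ᵐ x ∂μ,
      v g (x * (k : G)⁻¹) * φ k x = φ k (g * x) * v g x) {ε : ℝ} (hε : 0 < ε) :
    ∃ V ∈ 𝓝 (1 : G), ∀ k : Λ, ∀ t, (∀ s : G, s * t * s⁻¹ ∈ V) →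
      μ.real {x | φ k (x * t) = φ k x} < ε ∨ 1 - ε < μ.real {x | φ k (x * t) = φ k x} := by
  obtain ⟨F, δ, hδ, hF⟩ := hΓ.exists_finset hε
  have hV : ∀ᶠ t in 𝓝 (1 : G), ∀ g ∈ F, μ.real {x | v g (x * t) ≠ v g x} < δ / 2 :=
    (F.eventually_all).2 fun g _ => eventually_measureReal_mul_right_ne (hv g) (half_pos hδ)
  refine ⟨_, hV, fun k t ht => hF _ (measurableSet_eq_of_discrete
    ((hφ k).comp (measurable_mul_const t)) (hφ k)) fun g hg => ?_⟩
  set A := {x | φ k (x * t) = φ k x}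
  have himg : (fun x => g • x) '' A = {x | (g : G)⁻¹ * x ∈ A} := by
    ext y
    constructor
    · rintro ⟨x, hx, rfl⟩
      change (g : G)⁻¹ * (g * x) ∈ A
      rwa [inv_mul_cancel_left]
    · exact fun hy => ⟨(g : G)⁻¹ * y, hy, mul_inv_cancel_left _ _⟩
  have h1 : μ.real {x | v g (x * t) ≠ v g x} < δ / 2 := by simpa using ht 1 g hg
  have h2 : μ.real {x | v g (x * (k : G)⁻¹ * (k * t * (k : G)⁻¹)) ≠ v g (x * (k : G)⁻¹)}
      < δ / 2 := by
    rw [measureReal_mul_right (fun x => v g (x * (k * t * (k : G)⁻¹)) ≠ v g x)]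
    exact ht k g hg
  calc μ.real (symmDiff ((fun x => g • x) '' A) A)
      = μ.real {x | (g : G) * x ∈ symmDiff ((fun x => g • x) '' A) A} :=
        (measureReal_mul_left (fun x => x ∈ symmDiff ((fun x => g • x) '' A) A) (g : G)).symm
    _ ≤ μ.real {x | v g (x * t) ≠ v g x} +
        μ.real {x | v g (x * (k : G)⁻¹ * (k * t * (k : G)⁻¹)) ≠ v g (x * (k : G)⁻¹)} := ?_
    _ ≤ δ := by linarith
  refine measureReal_setOf_le_add ?_
  filter_upwards [hvφ g k, ae_mul_right (hvφ g k) t] with x hx hxt hxA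
  by_contra! hcon
  obtain ⟨h3, h4⟩ := hcon
  have h5 : x * (k : G)⁻¹ * (k * t * (k : G)⁻¹) = x * t * (k : G)⁻¹ := by group
  rw [h5] at h4
  rw [h3, h4, ← mul_assoc] at hxt
  have h6 : φ k (g * x * t) = φ k (g * x) ↔ φ k (x * t) = φ k x := by
    rw [← mul_inv_eq_iff_eq_mul] at hx hxt
    rw [← hx, ← hxt]
    simp
  rw [himg] at hxA
  change ((g : G)⁻¹ * (g * x) ∈ A ∧ (g : G) * x ∉ A) ∨ ((g : G) * x ∈ A ∧
    (g : G)⁻¹ * (g * x) ∉ A) at hxA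
  rw [inv_mul_cancel_left] at hxA
  exact hxA.elim (fun h => h.2 (h6.2 h.1)) (fun h => h.2 (h6.1 h.1))

/-- If `Λ` is finitely generated, right translations by small elements move all the maps `φ k`
by a uniformly small amount. By induction on word length `φ k (x * t) = φ k x` holds on a set
of measure at least `1 - 2 ε`, and the alternative for this set improves this to `1 - ε`. -/
theorem exists_nhds_uniformly_close (hΓ : StronglyErgodic Γ μ) (hΛ : Λ.FG)
    (hv : ∀ g, Measurable (v g)) (hφ : ∀ k, Measurable (φ k))
    (hvφ : ∀ (g : Γ) (k : Λ), ∀ᵐ x ∂μ, v g (x * (k : G)⁻¹) * φ k x = φ k (g * x) * v g x)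
    (hφmul : ∀ k k' : Λ, ∀ᵐ x ∂μ, φ (k * k') x = φ k (x * (k' : G)⁻¹) * φ k' x)
    {ε : ℝ} (hε : 0 < ε) :
    ∃ V : Set G, IsOpen V ∧ 1 ∈ V ∧ (∀ g, ∀ t ∈ V, g * t * g⁻¹ ∈ V) ∧
      ∀ k : Λ, ∀ t ∈ V, μ.real {x | φ k (x * t) ≠ φ k x} ≤ ε := by
  wlog hε' : ε ≤ 1 / 4 generalizing ε
  · obtain ⟨V, h1, h2, h3, h4⟩ := this (ε := 1 / 4) (by norm_num) le_rfl
    exact ⟨V, h1, h2, h3, fun k t ht => (h4 k t ht).trans (by linarith)⟩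
  obtain ⟨V₁, hV₁, hdich⟩ := exists_nhds_almost_null_or_conull hΓ hv hφ hvφ hε
  obtain ⟨S, hS⟩ := (Group.fg_iff_subgroup_fg Λ).2 hΛ
  have hV₂ : ∀ᶠ t in 𝓝 (1 : G), ∀ k ∈ S, μ.real {x | φ k (x * t) ≠ φ k x} < ε :=
    (S.eventually_all).2 fun k _ => eventually_measureReal_mul_right_ne (hφ k) hε
  obtain ⟨V, hVo, h1V, hVsub, hVconj⟩ := exists_isOpen_conj_invariant (inter_mem hV₁ hV₂)
  refine ⟨V, hVo, h1V, hVconj, ?_⟩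
  have hcompl : ∀ (k : Λ) (t : G), μ.real {x | φ k (x * t) = φ k x} =
      1 - μ.real {x | φ k (x * t) ≠ φ k x} := fun k t => by
    have h := probReal_compl_eq_one_sub (μ := μ) (measurableSet_eq_of_discrete
      ((hφ k).comp (measurable_mul_const t)) (hφ k))
    change μ.real {x | φ k (x * t) ≠ φ k x} = 1 - μ.real {x | φ k (x * t) = φ k x} at h
    linarith
  have himp : ∀ (k : Λ), ∀ t ∈ V, μ.real {x | φ k (x * t) ≠ φ k x} ≤ 2 * ε →
      μ.real {x | φ k (x * t) ≠ φ k x} ≤ ε := fun k t ht h => by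
    have h' := hdich k t fun s => (hVsub (hVconj s t ht)).1
    rw [hcompl] at h'
    rcases h' with h' | h' <;> linarith
  intro k
  have hk : k ∈ Subgroup.closure (S : Set Λ) := hS ▸ Subgroup.mem_top k
  induction hk using Subgroup.closure_induction with
  | mem k hk => exact fun t ht => ((hVsub ht).2 k hk).le
  | one =>
    intro t ht
    have h1 : ∀ᵐ x ∂μ, φ 1 x = 1 := by
      filter_upwards [hφmul 1 1] with x hx
      simpa using hx
    have h0 : μ.real {x | φ 1 (x * t) ≠ φ 1 x} = 0 := by
      rw [measureReal_eq_zero_iff, ← compl_mem_ae_iff]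
      filter_upwards [h1, ae_mul_right h1 t] with x hx hxt
      simp [hx, hxt]
    rw [h0]
    exact hε.le
  | mul k k' _ _ hk hk' =>
    intro t ht
    refine himp _ t ht ?_
    have h1 := hk _ (hVconj k' t ht)
    rw [← measureReal_mul_right (fun x => φ k (x * (k' * t * (k' : G)⁻¹)) ≠ φ k x)
      (k' : G)⁻¹] at h1
    have h2 : μ.real {x | φ (k * k') (x * t) ≠ φ (k * k') x} ≤
        μ.real {x | φ k (x * (k' : G)⁻¹ * (k' * t * (k' : G)⁻¹)) ≠ φ k (x * (k' : G)⁻¹)} +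
        μ.real {x | φ k' (x * t) ≠ φ k' x} := by
      refine measureReal_setOf_le_add ?_
      filter_upwards [hφmul k k', ae_mul_right (hφmul k k') t] with x hx hxt hne
      by_contra! hcon
      have h5 : x * (k' : G)⁻¹ * (k' * t * (k' : G)⁻¹) = x * t * (k' : G)⁻¹ := by group
      rw [h5] at hcon
      exact hne (by rw [hx, hxt, hcon.1, hcon.2])
    linarith [hk' t ht]
  | inv k _ hk =>
    intro t ht
    have h1 := hk _ (hVconj (k : G)⁻¹ t ht)
    rw [← measureReal_mul_right (fun x => φ k (x * ((k : G)⁻¹ * t * ((k : G)⁻¹)⁻¹)) ≠ φ k x)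
      (k : G)] at h1
    refine le_trans ?_ h1
    have h2 : ∀ᵐ x ∂μ, φ k (x * k) * φ k⁻¹ x = 1 := by
      filter_upwards [hφmul k k⁻¹, hφmul 1 1] with x hx hx1
      rw [mul_inv_cancel] at hx
      have h1 : φ 1 x = 1 := by simpa using hx1
      simpa [h1] using hx.symm
    refine ENNReal.toReal_mono (measure_ne_top _ _) (measure_mono_ae ?_)
    filter_upwards [h2, ae_mul_right h2 t] with x hx hxt hne heq
    have h5 : x * (k : G) * ((k : G)⁻¹ * t * ((k : G)⁻¹)⁻¹) = x * t * k := by group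
    rw [h5] at heq
    exact hne (mul_left_cancel (a := φ k (x * k)) (by rw [hx, ← heq, hxt]))

end Uniform

/-! ### Intertwiners between left translates of the right cocycle -/

theorem measureReal_eq_one_of_ae {X : Type*} [MeasurableSpace X] {μ : Measure X}
    [IsProbabilityMeasure μ] {p : X → Prop} (h : ∀ᵐ x ∂μ, p x) : μ.real {x | p x} = 1 := by
  rw [measureReal_def, measure_congr (eventuallyEq_univ.2 h), measure_univ, ENNReal.toReal_one]

section Intertwiner

variable {G : Type*} [Group G] [MeasurableSpace G] {Λ : Subgroup G}
  {Δ : Type*} [Group Δ] [MeasurableSpace Δ]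

/-- A measurable map `ψ` conjugating the cocycle `φ` for the right translation action of `Λ` into
its left translate `x ↦ φ k (s * x)`. The pairs `(s, ψ)` form a group extension of the group of
all `s` for which some `ψ` exists. -/
structure IsIntertwiner (μ : Measure G) (φ : Λ → G → Δ) (s : G) (ψ : G → Δ) : Prop where
  measurable : Measurable ψ
  map_mul : ∀ k : Λ, ∀ᵐ x ∂μ, ψ (x * (k : G)⁻¹) * φ k x = φ k (s * x) * ψ x

/-- The elements of `G` carrying an intertwiner that is trivial outside a set of measure `ε`. -/
def nearTrivial (μ : Measure G) (φ : Λ → G → Δ) (ε : ℝ) : Set G :=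
  {s | ∃ ψ, IsIntertwiner μ φ s ψ ∧ μ.real {x | ψ x ≠ 1} ≤ ε}

variable {μ : Measure G} {φ : Λ → G → Δ} {s t : G} {ψ ψ' : G → Δ}

theorem nearTrivial_mono {ε ε' : ℝ} (h : ε ≤ ε') : nearTrivial μ φ ε ⊆ nearTrivial μ φ ε' :=
  fun _ ⟨ψ, h1, h2⟩ => ⟨ψ, h1, h2.trans h⟩

variable [MeasurableMul G] [μ.IsMulLeftInvariant] [Countable Δ] [DiscreteMeasurableSpace Δ]

theorem IsIntertwiner.mul (h : IsIntertwiner μ φ s ψ) (h' : IsIntertwiner μ φ t ψ') :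
    IsIntertwiner μ φ (s * t) fun x => ψ (t * x) * ψ' x where
  measurable := (h.measurable.comp (measurable_const_mul t)).mul h'.measurable
  map_mul k := by
    filter_upwards [ae_mul_left (h.map_mul k) t, h'.map_mul k] with x hx hx'
    rw [mul_assoc, hx', ← mul_assoc, ← mul_assoc t, hx, mul_assoc, mul_assoc]

omit [Countable Δ] in
theorem IsIntertwiner.inv (h : IsIntertwiner μ φ s ψ) :
    IsIntertwiner μ φ s⁻¹ fun x => (ψ (s⁻¹ * x))⁻¹ where
  measurable := (h.measurable.comp (measurable_const_mul s⁻¹)).inv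
  map_mul k := by
    filter_upwards [ae_mul_left (h.map_mul k) s⁻¹] with x hx
    rw [mul_inv_cancel_left] at hx
    rw [inv_mul_eq_iff_eq_mul, ← mul_assoc, eq_mul_inv_iff_mul_eq, ← mul_assoc s⁻¹, ← hx]

theorem mul_mem_nearTrivial [IsFiniteMeasure μ] {ε ε' : ℝ} (hs : s ∈ nearTrivial μ φ ε)
    (ht : t ∈ nearTrivial μ φ ε') :
    s * t ∈ nearTrivial μ φ (ε + ε') := by
  obtain ⟨ψ, hψ, h1⟩ := hs
  obtain ⟨ψ', hψ', h2⟩ := ht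
  refine ⟨_, hψ.mul hψ', ?_⟩
  rw [← measureReal_mul_left (fun x => ψ x ≠ 1) t] at h1
  refine le_trans (measureReal_setOf_le_add (ae_of_all _ fun x hx => ?_)) (add_le_add h1 h2)
  by_contra! hcon
  exact hx (by rw [hcon.1, hcon.2, mul_one])

omit [Countable Δ] in
theorem inv_mem_nearTrivial {ε : ℝ} (hs : s ∈ nearTrivial μ φ ε) :
    s⁻¹ ∈ nearTrivial μ φ ε := by
  obtain ⟨ψ, hψ, h1⟩ := hs
  refine ⟨_, hψ.inv, ?_⟩
  rw [← measureReal_mul_left (fun x => ψ x ≠ 1) s⁻¹] at h1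
  simpa using h1

end Intertwiner

section

variable {G : Type*} [Group G] [TopologicalSpace G] [IsTopologicalGroup G]
  [SecondCountableTopology G] [MeasurableSpace G] [BorelSpace G]
  {μ : Measure G} [IsProbabilityMeasure μ] [μ.InnerRegular] [μ.IsMulRightInvariant]
  {Λ : Subgroup G} {Δ : Type*} [Group Δ] [Countable Δ] [MeasurableSpace Δ]
  [DiscreteMeasurableSpace Δ] {φ : Λ → G → Δ} {s : G} {ψ ψ' : G → Δ}

/-- By ergodicity of `Λ`, two intertwiners over the same element that agree on a set of positive
measure agree almost everywhere. -/
theorem IsIntertwiner.ae_eq (hΛ : Dense (Λ : Set G)) (h : IsIntertwiner μ φ s ψ)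
    (h' : IsIntertwiner μ φ s ψ') (hlt : μ.real {x | ψ x ≠ ψ' x} < 1) : ψ =ᵐ[μ] ψ' := by
  have hinv : ∀ k ∈ Λ, ∀ᵐ x ∂μ, ψ (x * k) = ψ' (x * k) ↔ ψ x = ψ' x := fun k hk => by
    filter_upwards [h.map_mul ⟨k⁻¹, Λ.inv_mem hk⟩, h'.map_mul ⟨k⁻¹, Λ.inv_mem hk⟩] with x hx hx'
    rw [inv_inv] at hx hx'
    rw [← mul_right_cancel_iff (a := φ ⟨k⁻¹, Λ.inv_mem hk⟩ x), hx, hx', mul_right_inj]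
  rcases ae_or_ae_not_of_mul_right_invariant hΛ
    (measurableSet_eq_of_discrete h.measurable h'.measurable) hinv with h1 | h1
  · exact h1
  · exact absurd (measureReal_eq_one_of_ae h1) hlt.ne

theorem IsIntertwiner.ae_eq_of_near (hΛ : Dense (Λ : Set G)) (h : IsIntertwiner μ φ s ψ)
    (h' : IsIntertwiner μ φ s ψ') (hlt : μ.real {x | ψ x ≠ 1} + μ.real {x | ψ' x ≠ 1} < 1) :
    ψ =ᵐ[μ] ψ' := by
  refine h.ae_eq hΛ h' (lt_of_le_of_lt (measureReal_setOf_le_add (ae_of_all _ fun x hx => ?_)) hlt)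
  by_contra! hcon
  exact hx (by rw [hcon.1, hcon.2])

omit [DiscreteMeasurableSpace Δ] in
/-- An equivariant field of subsets of `Δ` that equals `{1}` on most of `G` consists of singletons
almost everywhere, by ergodicity, and so defines an intertwiner close to `1`. -/
theorem mem_nearTrivial_of_equivariant (hΛ : Dense (Λ : Set G)) {β : G → Set Δ}
    (hβ : ∀ d, MeasurableSet {x | d ∈ β x})
    (hinv : ∀ k : Λ, ∀ᵐ x ∂μ, ∀ d,
      φ k (s * x) * d * (φ k x)⁻¹ ∈ β (x * (k : G)⁻¹) ↔ d ∈ β x)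
    {ε : ℝ} (hε : ε < 1) (hβε : μ.real {x | ¬ ∀ d, d ∈ β x ↔ d = 1} ≤ ε) :
    s ∈ nearTrivial μ φ ε := by
  classical
  have hD : MeasurableSet {x | ∃ d, d ∈ β x ∧ ∀ d', d' ∈ β x → d' = d} := by
    have : {x | ∃ d, d ∈ β x ∧ ∀ d', d' ∈ β x → d' = d} =
        ⋃ d, ({x | d ∈ β x} ∩ ⋂ d', {x | d' ∈ β x → d' = d}) := by
      ext x; simp
    rw [this]
    refine MeasurableSet.iUnion fun d => (hβ d).inter (MeasurableSet.iInter fun d' => ?_)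
    by_cases hdd : d' = d
    · simp [hdd]
    · simp only [hdd, imp_false]
      exact (hβ d').compl
  have huniq : ∀ᵐ x ∂μ, ∃ d, d ∈ β x ∧ ∀ d', d' ∈ β x → d' = d := by
    refine (ae_or_ae_not_of_mul_right_invariant hΛ hD fun k hk => ?_).resolve_right fun hnot => ?_
    · filter_upwards [hinv ⟨k⁻¹, Λ.inv_mem hk⟩] with x hx
      rw [inv_inv] at hx
      set a := φ ⟨k⁻¹, Λ.inv_mem hk⟩ (s * x)
      set b := φ ⟨k⁻¹, Λ.inv_mem hk⟩ x
      have hx' : ∀ d, d ∈ β (x * k) ↔ a⁻¹ * d * b ∈ β x := fun d => by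
        rw [← hx]; congr! 1; group
      constructor
      · rintro ⟨d, hd, hd'⟩
        refine ⟨_, (hx' d).1 hd, fun d' h' => ?_⟩
        rw [← hd' _ ((hx d').2 h')]; group
      · rintro ⟨d, hd, hd'⟩
        refine ⟨_, (hx d).2 hd, fun d' h' => ?_⟩
        rw [← hd' _ ((hx' d').1 h')]; group
    · have h1 : μ.real {x | ¬ ∀ d, d ∈ β x ↔ d = 1} = 1 := by
        refine measureReal_eq_one_of_ae ?_
        filter_upwards [hnot] with x hx h1
        exact hx ⟨1, (h1 1).2 rfl, fun d' h' => (h1 d').1 h'⟩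
      linarith
  let ψ : G → Δ := fun x => if h : ∃ d, d ∈ β x ∧ ∀ d', d' ∈ β x → d' = d then h.choose else 1
  have hψ : ∀ x d, d ∈ β x → (∀ d', d' ∈ β x → d' = d) → ψ x = d := fun x d hd hd' => by
    have h : ∃ d, d ∈ β x ∧ ∀ d', d' ∈ β x → d' = d := ⟨d, hd, hd'⟩
    simp only [ψ, dif_pos h]
    exact hd' _ h.choose_spec.1
  refine ⟨ψ, ⟨?_, fun k => ?_⟩, le_trans (measureReal_mono ?_) hβε⟩
  · refine measurable_to_countable' fun d => ?_
    have : ψ ⁻¹' {d} = ({x | ∃ d, d ∈ β x ∧ ∀ d', d' ∈ β x → d' = d} ∩ {x | d ∈ β x}) ∪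
        ({x | ∃ d, d ∈ β x ∧ ∀ d', d' ∈ β x → d' = d}ᶜ ∩ {_x | d = 1}) := by
      ext x
      by_cases h : ∃ d, d ∈ β x ∧ ∀ d', d' ∈ β x → d' = d
      · obtain ⟨d₀, h1, h2⟩ := id h
        have h3 := hψ x d₀ h1 h2
        simp only [Set.mem_preimage, Set.mem_singleton_iff, h3, Set.mem_union, Set.mem_inter_iff,
          Set.mem_ofPred_eq, h, true_and, Set.mem_compl_iff, not_true_eq_false, false_and, or_false]
        exact ⟨fun h => h ▸ h1, fun h => (h2 d h).symm⟩
      · simp only [Set.mem_preimage, Set.mem_singleton_iff, Set.mem_union, Set.mem_inter_iff,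
          Set.mem_ofPred_eq, h, false_and, Set.mem_compl_iff, not_false_eq_true, true_and,
          false_or, ψ]
        exact eq_comm
    rw [this]
    exact (hD.inter (hβ d)).union (hD.compl.inter (MeasurableSet.const _))
  · filter_upwards [hinv k, huniq, ae_mul_right huniq (k : G)⁻¹]
      with x hx ⟨d, h1, h2⟩ ⟨d', h1', h2'⟩
    have h3 := (hx d).2 h1
    rw [hψ x d h1 h2, hψ _ d' h1' h2', ← h2' _ h3]
    group
  · exact fun x hx h => hx (hψ x 1 ((h 1).2 rfl) fun d' => (h d').1)

end

/-! ### Intertwiners over a neighbourhood of the identity -/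

section Steinhaus

variable {G : Type*} [Group G] [TopologicalSpace G] [IsTopologicalGroup G]
  [CompactSpace G] [PolishSpace G] [MeasurableSpace G] [BorelSpace G]
  {μ : Measure G} [μ.IsHaarMeasure] [IsProbabilityMeasure μ] [μ.IsMulRightInvariant]
  {Λ : Subgroup G} [Countable Λ]
  {Δ : Type*} [Group Δ] [Countable Δ] [MeasurableSpace Δ] [DiscreteMeasurableSpace Δ]
  {φ : Λ → G → Δ}

omit [IsProbabilityMeasure μ] [Group Δ] in
/-- Closeness under right translations by a conjugation invariant set `V` becomes, on average,
closeness under left translations by `V`, since `s * x = x * (x⁻¹ * s * x)`. -/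
theorem measure_mul_left_ne_le {f : G → Δ} (hf : Measurable f) {V : Set G} (hV : MeasurableSet V)
    (hVconj : ∀ g, ∀ t ∈ V, g * t * g⁻¹ ∈ V) {ε : ENNReal}
    (h : ∀ t ∈ V, μ {x | f (x * t) ≠ f x} ≤ ε) :
    ((μ.restrict V).prod μ) {z | f (z.1 * z.2) ≠ f z.2} ≤ ε * μ V := by
  have hm1 : MeasurableSet {z : G × G | f (z.1 * z.2) ≠ f z.2} :=
    (measurableSet_eq_of_discrete (hf.comp measurable_mul) (hf.comp measurable_snd)).compl
  have hm2 : MeasurableSet {z : G × G | f (z.2 * z.1) ≠ f z.2} :=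
    (measurableSet_eq_of_discrete (hf.comp (measurable_snd.mul measurable_fst))
      (hf.comp measurable_snd)).compl
  have hconj : ∀ x : G, MeasurePreserving (fun t => x * t * x⁻¹) (μ.restrict V) (μ.restrict V) := by
    intro x
    have h1 : MeasurePreserving (fun t => x * t * x⁻¹) μ μ :=
      (measurePreserving_mul_right μ x⁻¹).comp (measurePreserving_mul_left μ x)
    have h2 : (fun t => x * t * x⁻¹) ⁻¹' V = V := by
      ext t
      refine ⟨fun ht => ?_, hVconj x t⟩
      simpa [mul_assoc] using hVconj x⁻¹ _ ht
    simpa [h2] using h1.restrict_preimage hV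
  calc ((μ.restrict V).prod μ) {z | f (z.1 * z.2) ≠ f z.2}
      = ∫⁻ x, (μ.restrict V) {t | f (t * x) ≠ f x} ∂μ := Measure.prod_apply_symm hm1
    _ = ∫⁻ x, (μ.restrict V) {t | f (x * t) ≠ f x} ∂μ := by
      refine lintegral_congr fun x => ?_
      have hx := (hconj x).measure_preimage (s := {t | f (t * x) ≠ f x})
        (measurableSet_eq_of_discrete (hf.comp (measurable_mul_const x))
          measurable_const).compl.nullMeasurableSet
      rw [← hx]
      simp
    _ = ((μ.restrict V).prod μ) {z | f (z.2 * z.1) ≠ f z.2} := (Measure.prod_apply_symm hm2).symm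
    _ = ∫⁻ t in V, μ {x | f (x * t) ≠ f x} ∂μ := Measure.prod_apply hm2
    _ ≤ ∫⁻ _ in V, ε ∂μ := setLIntegral_mono measurable_const h
    _ = ε * μ V := by rw [setLIntegral_const]

/-- The set `nearTrivial μ φ ε` contains a measurable set of positive measure: the graph
of the constant field `1` is almost invariant under the skew product action of `Λ` on `V × G × Δ`,
and a nearby invariant set provides intertwiners for most elements of `V`. -/
theorem exists_measurableSet_subset_nearTrivial (hΛ : Dense (Λ : Set G))
    (hφ : ∀ k, Measurable (φ k))
    (hφmul : ∀ k k' : Λ, ∀ᵐ x ∂μ, φ (k * k') x = φ k (x * (k' : G)⁻¹) * φ k' x)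
    {ε : ℝ} (hε : 0 < ε) (hε1 : ε < 1) {V : Set G} (hVo : IsOpen V) (h1V : 1 ∈ V)
    (hVconj : ∀ g, ∀ t ∈ V, g * t * g⁻¹ ∈ V)
    (hclose : ∀ k : Λ, ∀ t ∈ V, μ.real {x | φ k (x * t) ≠ φ k x} ≤ ε / 16) :
    ∃ S, MeasurableSet S ∧ 0 < μ S ∧ S ⊆ nearTrivial μ φ ε := by
  set ν := (μ.restrict V).prod μ with hν
  set m := ν.prod (Measure.count : Measure Δ) with hm
  have hVpos : 0 < μ V := hVo.measure_pos μ ⟨1, h1V⟩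
  let T : Λ → (G × G) × Δ → (G × G) × Δ := fun k z =>
    ((z.1.1, z.1.2 * (k : G)⁻¹), φ k (z.1.1 * z.1.2) * z.2 * (φ k z.1.2)⁻¹)
  have hφ1 : ∀ k, Measurable fun z : (G × G) × Δ => φ k (z.1.1 * z.1.2) := fun k =>
    (hφ k).comp (measurable_mul.comp measurable_fst)
  have hφ2 : ∀ k, Measurable fun z : (G × G) × Δ => φ k z.1.2 := fun k =>
    (hφ k).comp (measurable_snd.comp measurable_fst)
  have hT : ∀ k, MeasurePreserving (T k) m m := by
    intro k
    refine MeasurePreserving.skew_product (f := fun z : G × G => (z.1, z.2 * (k : G)⁻¹))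
      (g := fun z d => φ k (z.1 * z.2) * d * (φ k z.2)⁻¹)
      ((MeasurePreserving.id _).prod (measurePreserving_mul_right μ _))
      (((hφ1 k).mul measurable_snd).mul (hφ2 k).inv) (ae_of_all _ fun z => ?_)
    exact ((measurePreserving_mul_right Measure.count _).comp
      (measurePreserving_mul_left Measure.count _)).map_eq
  set A : Set ((G × G) × Δ) := Set.univ ×ˢ {1} with hA
  have hAm : MeasurableSet A := MeasurableSet.univ.prod (measurableSet_singleton _)
  have hmA : m A = μ V := by
    rw [hm, hA, Measure.prod_prod, Measure.count_singleton, hν, ← Set.univ_prod_univ,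
      Measure.prod_prod]
    simp
  have hcoc : ∀ k j : Λ, ∀ᵐ z ∂m, φ (k * j) (z.1.1 * z.1.2) =
      φ k (z.1.1 * (z.1.2 * (j : G)⁻¹)) * φ j (z.1.1 * z.1.2) ∧
      φ (k * j) z.1.2 = φ k (z.1.2 * (j : G)⁻¹) * φ j z.1.2 := by
    intro k j
    have h1 : ∀ᵐ z ∂ν, φ (k * j) (z.1 * z.2) =
        φ k (z.1 * (z.2 * (j : G)⁻¹)) * φ j (z.1 * z.2) := by
      have := ((Measure.quasiMeasurePreserving_snd (μ := μ.restrict V) (ν := μ)).comp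
        (measurePreserving_prod_mul (μ.restrict V) μ).quasiMeasurePreserving).ae (hφmul k j)
      filter_upwards [this] with z hz
      rw [← mul_assoc]; exact hz
    have h2 : ∀ᵐ z ∂ν, φ (k * j) z.2 = φ k (z.2 * (j : G)⁻¹) * φ j z.2 :=
      Measure.quasiMeasurePreserving_snd.ae (hφmul k j)
    exact Measure.quasiMeasurePreserving_fst.ae (h1.and h2)
  have hperm : ∀ j k : Λ, ∃ l, T j ⁻¹' (T k ⁻¹' A) =ᵐ[m] T l ⁻¹' A := by
    intro j k
    refine ⟨k * j, ?_⟩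
    filter_upwards [hcoc k j] with z ⟨h1, h2⟩
    refine congrArg (· ∈ A) (Prod.ext (Prod.ext rfl ?_) ?_)
    · change z.1.2 * (j : G)⁻¹ * (k : G)⁻¹ = z.1.2 * ((k * j : Λ) : G)⁻¹
      simp [mul_assoc]
    · change φ k (z.1.1 * (z.1.2 * (j : G)⁻¹)) * (φ j (z.1.1 * z.1.2) * z.2 * (φ j z.1.2)⁻¹) *
        (φ k (z.1.2 * (j : G)⁻¹))⁻¹ = φ (k * j) (z.1.1 * z.1.2) * z.2 * (φ (k * j) z.1.2)⁻¹
      rw [h1, h2]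
      group
  have hAT : ∀ k, m (A \ T k ⁻¹' A) ≤ ENNReal.ofReal (ε / 16) * μ V := by
    intro k
    have h1 : A \ T k ⁻¹' A ⊆ {z : G × G | φ k (z.1 * z.2) ≠ φ k z.2} ×ˢ {1} := by
      rintro ⟨z, d⟩ ⟨⟨-, hd⟩, h2⟩
      refine ⟨fun h => h2 ⟨trivial, ?_⟩, hd⟩
      change φ k _ * d * (φ k _)⁻¹ = 1
      rw [h, show d = 1 from hd]
      simp
    refine (measure_mono h1).trans ?_
    rw [hm, Measure.prod_prod, Measure.count_singleton, mul_one]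
    refine measure_mul_left_ne_le (hφ k) hVo.measurableSet hVconj fun t ht => ?_
    rw [← ENNReal.ofReal_toReal (measure_ne_top μ {x | φ k (x * t) ≠ φ k x})]
    exact ENNReal.ofReal_le_ofReal (hclose k t ht)
  have hsymm : ∀ k, m.real (symmDiff (T k ⁻¹' A) A) ≤ ε / 8 * μ.real V := by
    intro k
    have h1 : m (T k ⁻¹' A) = m A := (hT k).measure_preimage hAm.nullMeasurableSet
    have h2 : m (T k ⁻¹' A \ A) = m (A \ T k ⁻¹' A) :=
      measure_sdiff_symm ((hT k).measurable hAm).nullMeasurableSet hAm.nullMeasurableSet h1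
        (ne_top_of_le_ne_top (by rw [hmA]; exact measure_ne_top _ _)
          (measure_mono Set.inter_subset_right))
    have h3 : m (symmDiff (T k ⁻¹' A) A) ≤ ENNReal.ofReal (ε / 8 * μ.real V) := by
      refine (measure_union_le _ _).trans ?_
      rw [h2]
      refine (add_le_add (hAT k) (hAT k)).trans ?_
      rw [ENNReal.ofReal_mul (by positivity), measureReal_def,
        ENNReal.ofReal_toReal (measure_ne_top _ _), ← add_mul,
        ← ENNReal.ofReal_add (by positivity) (by positivity)]
      refine mul_le_mul_left (ENNReal.ofReal_le_ofReal (by linarith)) _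
    exact ENNReal.toReal_le_of_le_ofReal (by positivity) h3
  obtain ⟨B, hB, hBinv, hBA⟩ := exists_invariant_set_near hT hAm
    (by rw [hmA]; exact measure_ne_top _ _) hperm (by positivity) hsymm
  let β : G → G → Set Δ := fun s x => {d | ((s, x), d) ∈ B}
  -- the points at which the fibre of the invariant set is not the expected one
  let N : Set (G × G) := {z | ¬ ∀ d, d ∈ β z.1 z.2 ↔ d = 1}
  have hβm : ∀ d, MeasurableSet {z : G × G | d ∈ β z.1 z.2} := fun d =>
    (measurable_id.prodMk measurable_const) hB
  have hN : MeasurableSet N := by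
    have : N = ⋃ d, {z | ¬ (d ∈ β z.1 z.2 ↔ d = 1)} := by ext; simp [N]
    rw [this]
    refine MeasurableSet.iUnion fun d => ?_
    by_cases hd : d = 1
    · simp only [hd, iff_true]
      exact (hβm 1).compl
    · simp only [hd, iff_false, not_not]
      exact hβm d
  have hνN : ν N ≤ ENNReal.ofReal (ε / 2) * μ V := by
    calc ν N = ∫⁻ z, N.indicator 1 z ∂ν := (lintegral_indicator_one hN).symm
      _ ≤ ∫⁻ z, Measure.count (Prod.mk z ⁻¹' (symmDiff B A)) ∂ν := by
        refine lintegral_mono fun z => ?_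
        by_cases hz : z ∈ N
        · rw [Set.indicator_of_mem hz, Pi.one_apply]
          obtain ⟨d, hd⟩ := not_forall.1 hz
          have : d ∈ Prod.mk z ⁻¹' symmDiff B A := by
            by_cases hdB : (z, d) ∈ B
            · exact Or.inl ⟨hdB, fun h => hd (iff_of_true hdB h.2)⟩
            · have hd1 : d = 1 := by
                by_contra h
                exact hd (iff_of_false hdB h)
              exact Or.inr ⟨⟨trivial, hd1⟩, hdB⟩
          calc (1 : ENNReal) = Measure.count {d} := (Measure.count_singleton d).symm
            _ ≤ _ := measure_mono (Set.singleton_subset_iff.2 this)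
        · rw [Set.indicator_of_notMem hz]
          exact zero_le
      _ = m (symmDiff B A) := (Measure.prod_apply (hB.symmDiff hAm)).symm
      _ ≤ ENNReal.ofReal (4 * (ε / 8 * μ.real V)) := hBA
      _ = ENNReal.ofReal (ε / 2) * μ V := by
        rw [show 4 * (ε / 8 * μ.real V) = ε / 2 * μ.real V by ring,
          ENNReal.ofReal_mul (by positivity), measureReal_def,
          ENNReal.ofReal_toReal (measure_ne_top _ _)]
  have hinv : ∀ᵐ s ∂μ.restrict V, ∀ k : Λ, ∀ᵐ x ∂μ, ∀ d,
      φ k (s * x) * d * (φ k x)⁻¹ ∈ β s (x * (k : G)⁻¹) ↔ d ∈ β s x := by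
    refine ae_all_iff.2 fun k => ?_
    have h1 := Measure.ae_ae_of_ae_prod (Measure.ae_ae_of_ae_prod (hBinv k).mem_iff |>.mono
      fun z hz => (Measure.ae_count_iff.1 hz))
    exact h1
  -- the elements of `V` over which the invariant set is close to the constant field
  let S₁ : Set G := {s | μ (Prod.mk s ⁻¹' N) ≤ ENNReal.ofReal ε}
  have hS₁ : MeasurableSet S₁ := measurableSet_le (measurable_measure_prodMk_left hN)
    measurable_const
  obtain ⟨t, htsub, htm, ht0⟩ := exists_measurable_superset_of_null (ae_iff.1 hinv)
  refine ⟨(S₁ ∩ V) \ t, (hS₁.inter hVo.measurableSet).diff htm, ?_, ?_⟩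
  · have h1 : ENNReal.ofReal ε * (μ.restrict V) S₁ᶜ ≤ ENNReal.ofReal (ε / 2) * μ V := by
      refine le_trans ?_ hνN
      rw [hν, Measure.prod_apply hN]
      refine le_trans ?_ (mul_meas_ge_le_lintegral (measurable_measure_prodMk_left hN)
        (ENNReal.ofReal ε))
      refine mul_le_mul_right (measure_mono fun s hs => ?_) _
      have hs' : ¬ μ (Prod.mk s ⁻¹' N) ≤ ENNReal.ofReal ε := hs
      exact (not_le.1 hs').le
    have h2 : (μ.restrict V) S₁ ≠ 0 := fun h0 => by
      have h3 : (μ.restrict V) S₁ᶜ = μ V := by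
        rw [measure_compl hS₁ (measure_ne_top _ _), h0, tsub_zero, Measure.restrict_apply_univ]
      rw [h3, ENNReal.mul_le_mul_iff_left hVpos.ne' (measure_ne_top _ _),
        ENNReal.ofReal_le_ofReal_iff (by positivity)] at h1
      linarith
    have h4 : (μ.restrict V) ((S₁ ∩ V) \ t) ≠ 0 := by
      rw [measure_sdiff_null ht0, Measure.restrict_apply (hS₁.inter hVo.measurableSet),
        Set.inter_assoc, Set.inter_self, ← Measure.restrict_apply hS₁]
      exact h2
    exact pos_iff_ne_zero.2 fun h0 => h4 (Measure.restrict_le_self.absolutelyContinuous h0)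
  · rintro s ⟨⟨hs1, -⟩, hst⟩
    have hs : ∀ k : Λ, ∀ᵐ x ∂μ, ∀ d,
        φ k (s * x) * d * (φ k x)⁻¹ ∈ β s (x * (k : G)⁻¹) ↔ d ∈ β s x := by
      by_contra hcon
      exact hst (htsub hcon)
    exact mem_nearTrivial_of_equivariant hΛ (fun d => measurable_prodMk_left (hβm d)) hs hε1
      (ENNReal.toReal_le_of_le_ofReal hε.le hs1)

/-- Elements close to `1` carry intertwiners close to `1`. -/
theorem nearTrivial_mem_nhds (hΛ : Dense (Λ : Set G)) (hφ : ∀ k, Measurable (φ k))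
    (hφmul : ∀ k k' : Λ, ∀ᵐ x ∂μ, φ (k * k') x = φ k (x * (k' : G)⁻¹) * φ k' x)
    (hclose : ∀ ε : ℝ, 0 < ε → ∃ V : Set G, IsOpen V ∧ 1 ∈ V ∧ (∀ g, ∀ t ∈ V, g * t * g⁻¹ ∈ V) ∧
      ∀ k : Λ, ∀ t ∈ V, μ.real {x | φ k (x * t) ≠ φ k x} ≤ ε)
    {ε : ℝ} (hε : 0 < ε) : nearTrivial μ φ ε ∈ 𝓝 1 := by
  wlog hε1 : ε < 1 generalizing ε
  · exact mem_of_superset (this (ε := 1 / 2) (by norm_num) (by norm_num))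
      (nearTrivial_mono (by linarith))
  obtain ⟨V, hVo, h1V, hVconj, hV⟩ := hclose (ε / 2 / 16) (by positivity)
  obtain ⟨S, hS, hSpos, hSsub⟩ := exists_measurableSet_subset_nearTrivial hΛ hφ hφmul
    (half_pos hε) (by linarith) hVo h1V hVconj hV
  filter_upwards [Measure.div_mem_nhds_one_of_haar_pos μ S hS hSpos] with s hs
  obtain ⟨a, ha, b, hb, rfl⟩ := hs
  have := mul_mem_nearTrivial (hSsub ha) (inv_mem_nearTrivial (hSsub hb))
  rwa [add_halves, ← div_eq_mul_inv] at this

end Steinhaus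

/-! ### Untwisting along a one-parameter family of intertwiners -/

/-- A family of measurable maps into a countable discrete space that depends continuously on the
parameter, in measure, has a jointly measurable version. -/
theorem exists_jointly_measurable {H X Δ : Type*} [TopologicalSpace H]
    [SecondCountableTopology H] [MeasurableSpace H] [OpensMeasurableSpace H] [MeasurableSpace X]
    {μ : Measure X} [IsFiniteMeasure μ] [Countable Δ] [MeasurableSpace Δ]
    [DiscreteMeasurableSpace Δ] [Nonempty Δ] {F : H → X → Δ} (hF : ∀ s, Measurable (F s))
    (hcont : ∀ s, ∀ ε : ℝ, 0 < ε → ∀ᶠ t in 𝓝 s, μ.real {x | F t x ≠ F s x} ≤ ε) :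
    ∃ F' : H → X → Δ, Measurable (Function.uncurry F') ∧ ∀ s, F' s =ᵐ[μ] F s := by
  classical
  rcases isEmpty_or_nonempty H with hH | hH
  · exact ⟨F, measurable_of_empty _, fun s => (hH.false s).elim⟩
  obtain ⟨e, he, hesum⟩ := ENNReal.exists_pos_sum_of_countable (ε := 1) one_ne_zero ℕ
  have hcover : ∀ n, ∃ c : ℕ → H, ∀ t, ∃ i,
      t ∈ interior {t | μ.real {x | F t x ≠ F (c i) x} ≤ e n} := by
    intro n
    obtain ⟨S, hS, hSc⟩ := TopologicalSpace.countable_cover_nhds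
      (f := fun s => interior {t | μ.real {x | F t x ≠ F s x} ≤ e n})
      fun s => interior_mem_nhds.2 (hcont s _ (he n))
    have hSne : S.Nonempty := by
      by_contra h
      rw [Set.not_nonempty_iff_eq_empty.1 h] at hSc
      simp only [Set.mem_empty_iff_false, Set.iUnion_of_empty, Set.iUnion_empty] at hSc
      exact Set.empty_ne_univ hSc
    obtain ⟨c, rfl⟩ := hS.exists_eq_range hSne
    refine ⟨c, fun t => ?_⟩
    have ht : t ∈ ⋃ x ∈ Set.range c, interior {t | μ.real {y | F t y ≠ F x y} ≤ e n} :=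
      hSc ▸ Set.mem_univ t
    simpa using ht
  choose c hc using hcover
  let idx : ℕ → H → ℕ := fun n t => Nat.find (hc n t)
  have hidx : ∀ n, Measurable (idx n) := fun n =>
    measurable_find _ fun i => isOpen_interior.measurableSet
  let Fn : ℕ → H × X → Δ := fun n z => F (c n (idx n z.1)) z.2
  have hFn : ∀ n, Measurable (Fn n) := fun n => by
    have h1 : Measurable fun z : ℕ × X => F (c n z.1) z.2 :=
      measurable_from_prod_countable_right fun i => hF (c n i)
    exact h1.comp (((hidx n).comp measurable_fst).prodMk measurable_snd)
  have hlim : ∀ t, ∀ᵐ x ∂μ, ∀ᶠ n in atTop, Fn n (t, x) = F t x := by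
    intro t
    have hle : ∀ n, μ {x | F t x ≠ F (c n (idx n t)) x} ≤ e n := fun n => by
      have h1 : t ∈ {s | μ.real {x | F s x ≠ F (c n (idx n t)) x} ≤ e n} :=
        interior_subset (Nat.find_spec (hc n t))
      rw [← ENNReal.ofReal_toReal (measure_ne_top μ {x | F t x ≠ F (c n (idx n t)) x}),
        ← ENNReal.ofReal_coe_nnreal]
      exact ENNReal.ofReal_le_ofReal h1
    have h2 := ae_eventually_notMem (μ := μ) (s := fun n => {x | F t x ≠ F (c n (idx n t)) x})
      (ne_top_of_le_ne_top hesum.ne_top (ENNReal.tsum_le_tsum hle))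
    filter_upwards [h2] with x hx
    filter_upwards [hx] with n hn
    by_contra hne
    exact hn fun h => hne h.symm
  let D : Δ → Set (H × X) := fun d => {z | ∀ᶠ n in atTop, Fn n z = d}
  have hD : ∀ d, MeasurableSet (D d) := fun d => by
    have : D d = ⋃ N, ⋂ n ≥ N, Fn n ⁻¹' {d} := by
      ext z; simp [D, eventually_atTop]
    rw [this]
    exact MeasurableSet.iUnion fun N => MeasurableSet.biInter (Set.to_countable _)
      fun n _ => hFn n (measurableSet_singleton d)
  have huniq : ∀ z d d', z ∈ D d → z ∈ D d' → d = d' := fun z d d' h h' => by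
    obtain ⟨n, hn, hn'⟩ := (Filter.Eventually.and (show ∀ᶠ n in atTop, Fn n z = d from h)
      (show ∀ᶠ n in atTop, Fn n z = d' from h')).exists
    exact hn.symm.trans hn'
  let d₀ : Δ := Classical.arbitrary Δ
  let L : H × X → Δ := fun z => if h : ∃ d, z ∈ D d then h.choose else d₀
  have hL : ∀ z d, z ∈ D d → L z = d := fun z d hz => by
    have h : ∃ d, z ∈ D d := ⟨d, hz⟩
    simp only [L, dif_pos h]
    exact huniq z _ _ h.choose_spec hz
  refine ⟨fun s x => L (s, x), ?_, fun s => ?_⟩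
  · change Measurable L
    refine measurable_to_countable' fun d => ?_
    have : L ⁻¹' {d} = D d ∪ ((⋃ d, D d)ᶜ ∩ {_z | d = d₀}) := by
      ext z
      by_cases h : ∃ d, z ∈ D d
      · obtain ⟨d₁, hd₁⟩ := id h
        simp only [Set.mem_preimage, hL z d₁ hd₁, Set.mem_singleton_iff, Set.mem_union,
          Set.mem_inter_iff, Set.mem_compl_iff, Set.mem_iUnion, h, not_true_eq_false, false_and,
          or_false]
        exact ⟨fun h => h ▸ hd₁, fun h => huniq z _ _ hd₁ h⟩
      · have h' : z ∉ D d := fun h' => h ⟨d, h'⟩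
        simp only [Set.mem_preimage, Set.mem_singleton_iff, Set.mem_union, h', false_or,
          Set.mem_inter_iff, Set.mem_compl_iff, Set.mem_iUnion, h, not_false_eq_true, true_and,
          Set.mem_ofPred_eq, L]
        exact eq_comm
    rw [this]
    exact (hD d).union ((MeasurableSet.iUnion hD).compl.inter (MeasurableSet.const _))
  · filter_upwards [hlim s] with x hx using hL _ _ hx

section HaarNull

variable {H : Type*} [Group H] [MeasurableSpace H] [MeasurableMul₂ H] [MeasurableInv H]
  {ν : Measure H} [SFinite ν] [ν.IsMulLeftInvariant]

theorem ae_mul_right_iff {P : H → Prop} (y : H) : (∀ᵐ x ∂ν, P (x * y)) ↔ ∀ᵐ x ∂ν, P x :=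
  measure_mul_right_null (μ := ν) (s := {x | ¬ P x}) y

/-- A measurable homomorphism with non-null range pulls Haar null sets back to Haar null sets. -/
theorem quasiMeasurePreserving_of_range_ne_zero {G : Type*} [Group G] [MeasurableSpace G]
    [MeasurableMul₂ G] {μ : Measure G} [SFinite μ] [μ.IsMulLeftInvariant] {p : H →* G}
    (hp : Measurable p) (hrange : μ (Set.range p) ≠ 0) :
    Measure.QuasiMeasurePreserving p ν μ := by
  refine ⟨hp, Measure.AbsolutelyContinuous.mk fun A hA hA0 => ?_⟩
  have hm : MeasurableSet {z : H × G | p z.1 * z.2 ∉ A} :=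
    ((hp.comp measurable_fst).mul measurable_snd) hA.compl
  have h1 : ∀ᵐ x ∂μ, ∀ᵐ s ∂ν, p s * x ∉ A := by
    refine (Measure.ae_ae_comm hm).1 (ae_of_all _ fun s => ?_)
    exact ae_mul_left (p := fun x => x ∉ A) (measure_eq_zero_iff_ae_notMem.1 hA0) (p s)
  obtain ⟨x, hx, y, rfl⟩ : ∃ x, (∀ᵐ s ∂ν, p s * x ∉ A) ∧ x ∈ Set.range p := by
    by_contra! hcon
    exact hrange (measure_mono_null (fun x hx => by exact fun h => hcon x h hx) h1)
  rw [Measure.map_apply hp hA, measure_eq_zero_iff_ae_notMem]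
  refine (ae_mul_right_iff y).1 ?_
  filter_upwards [hx] with s hs
  simpa using hs

theorem exists_ae_eq_const_of_mul_left_invariant [NeZero ν] {Δ : Type*} [Countable Δ]
    [MeasurableSpace Δ] [DiscreteMeasurableSpace Δ] {f : H → Δ} (hf : Measurable f)
    (h : ∀ s, ∀ᵐ x ∂ν, f (s * x) = f x) : ∃ d, ∀ᵐ x ∂ν, f x = d := by
  have h1 := (Measure.ae_ae_comm (μ := ν) (ν := ν) (p := fun s x => f (s * x) = f x)
    (measurableSet_eq_of_discrete
    (hf.comp measurable_mul) (hf.comp measurable_snd))).1 (ae_of_all _ h)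
  obtain ⟨x, hx⟩ := h1.exists
  exact ⟨f x, (ae_mul_right_iff x).1 hx⟩

end HaarNull

section Untwist

variable {G : Type*} [Group G] [MeasurableSpace G] [MeasurableMul₂ G]
  {μ : Measure G} [IsFiniteMeasure μ] [μ.IsMulLeftInvariant]
  {H : Type*} [Group H] [TopologicalSpace H] [IsTopologicalGroup H]
  [SecondCountableTopology H] [MeasurableSpace H] [BorelSpace H]
  {ν : Measure H} [SFinite ν] [ν.IsMulLeftInvariant] [NeZero ν]
  {Δ : Type*} [Group Δ] [Countable Δ] [MeasurableSpace Δ] [DiscreteMeasurableSpace Δ]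
  {p : H →* G} {F : H → G → Δ}

/-- A cocycle of `H` for its action on `G` through `p` becomes a coboundary when it is pulled back
to `H`: it is the coboundary of its restriction to a generic orbit. -/
theorem exists_coboundary (hp : Measure.QuasiMeasurePreserving p ν μ)
    (hF : ∀ s, Measurable (F s))
    (hFmul : ∀ s t, ∀ᵐ x ∂μ, F (s * t) x = F s (p t * x) * F t x)
    (hF1 : ∀ ε : ℝ, 0 < ε → ∀ᶠ s in 𝓝 (1 : H), μ.real {x | F s x ≠ 1} ≤ ε) :
    ∃ ψ : H → Δ, Measurable ψ ∧ ∀ s, ∀ᵐ y ∂ν, ψ (s * y) = F s (p y) * ψ y := by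
  have hcont : ∀ s, ∀ ε : ℝ, 0 < ε → ∀ᶠ t in 𝓝 s, μ.real {x | F t x ≠ F s x} ≤ ε := by
    intro s ε hε
    have h1 : Tendsto (fun t => t * s⁻¹) (𝓝 s) (𝓝 1) := by
      have : Continuous fun t : H => t * s⁻¹ := by fun_prop
      simpa using this.tendsto s
    filter_upwards [h1.eventually (hF1 ε hε)] with t ht
    refine le_trans ?_ ht
    rw [← measureReal_mul_left (fun x => F (t * s⁻¹) x ≠ 1) (p s)]
    refine ENNReal.toReal_mono (measure_ne_top _ _) (measure_mono_ae ?_)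
    filter_upwards [hFmul (t * s⁻¹) s] with x hx hne h1
    rw [inv_mul_cancel_right] at hx
    exact hne (by rw [hx, h1, one_mul])
  obtain ⟨F', hF', hFF'⟩ := exists_jointly_measurable hF hcont
  -- a point whose orbit satisfies the cocycle identity almost everywhere
  obtain ⟨y₀, hy₀⟩ : ∃ y₀ : H, ∀ᵐ z ∂ν.prod ν,
      F' (z.1 * z.2) (p y₀) = F' z.1 (p z.2 * p y₀) * F' z.2 (p y₀) := by
    have hm : MeasurableSet {q : (H × H) × G |
        F' (q.1.1 * q.1.2) q.2 = F' q.1.1 (p q.1.2 * q.2) * F' q.1.2 q.2} := by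
      have m1 : Measurable fun q : (H × H) × G => q.1.1 := measurable_fst.comp measurable_fst
      have m2 : Measurable fun q : (H × H) × G => q.1.2 := measurable_snd.comp measurable_fst
      refine measurableSet_eq_of_discrete (hF'.comp ((m1.mul m2).prodMk measurable_snd))
        ((hF'.comp (m1.prodMk ((hp.measurable.comp m2).mul measurable_snd))).mul
          (hF'.comp (m2.prodMk measurable_snd)))
    have h1 := (Measure.ae_ae_comm (μ := ν.prod ν) (ν := μ) (p := fun (z : H × H) x =>
      F' (z.1 * z.2) x = F' z.1 (p z.2 * x) * F' z.2 x) hm).1 (ae_of_all _ fun z => by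
      filter_upwards [hFF' (z.1 * z.2), ae_mul_left (hFF' z.1) (p z.2), hFF' z.2,
        hFmul z.1 z.2] with x h1 h2 h3 h4
      rw [h1, h2, h3, h4])
    exact (hp.ae h1).exists
  let ψ : H → Δ := fun y => F' (y * y₀⁻¹) (p y₀)
  have hψ : Measurable ψ := hF'.comp ((measurable_mul_const _).prodMk measurable_const)
  refine ⟨ψ, hψ, ?_⟩
  have hgen : ∀ᵐ s ∂ν, ∀ᵐ y ∂ν, ψ (s * y) = F s (p y) * ψ y := by
    filter_upwards [Measure.ae_ae_of_ae_prod hy₀] with s hs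
    filter_upwards [(ae_mul_right_iff y₀⁻¹).2 hs, hp.ae (hFF' s)] with y h1 h2
    simp only [ψ]
    rw [mul_assoc s, h1, ← h2, ← map_mul, inv_mul_cancel_right]
  have hone : ∀ᵐ x ∂μ, F 1 x = 1 := by
    filter_upwards [hFmul 1 1] with x hx
    simpa using hx
  have hmul : ∀ s t, (∀ᵐ y ∂ν, ψ (s * y) = F s (p y) * ψ y) →
      (∀ᵐ y ∂ν, ψ (t * y) = F t (p y) * ψ y) →
      ∀ᵐ y ∂ν, ψ (s * t * y) = F (s * t) (p y) * ψ y := by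
    intro s t hs ht
    filter_upwards [ae_mul_left hs t, ht, hp.ae (hFmul s t)] with y h1 h2 h3
    rw [mul_assoc, h1, h2, h3, map_mul, mul_assoc]
  have hinv : ∀ s, (∀ᵐ y ∂ν, ψ (s * y) = F s (p y) * ψ y) →
      ∀ᵐ y ∂ν, ψ (s⁻¹ * y) = F s⁻¹ (p y) * ψ y := by
    intro s hs
    filter_upwards [ae_mul_left hs s⁻¹, hp.ae (hFmul s s⁻¹), hp.ae hone] with y h1 h2 h3
    rw [mul_inv_cancel, h3] at h2
    rw [mul_inv_cancel_left, map_mul] at h1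
    rw [h1, ← mul_assoc, mul_eq_one_iff_eq_inv'.1 h2.symm, inv_mul_cancel, one_mul]
  -- a conull set closed under products and inverses is the whole group
  intro s
  obtain ⟨t, h1, h2⟩ := (hgen.and (ae_mul_left hgen s)).exists
  simpa using hmul _ _ h2 (hinv t h1)

end Untwist

/-! ### Lifted cocycles -/

section Lift

variable {G H : Type*} [Group G] [Group H] {Γ Λ : Subgroup G} {p : H →* G}

/-- The homomorphism `p⁻¹(Γ) × p⁻¹(Λ) → Γ × Λ` along which cocycles are lifted. -/
def comapProdHom (Γ Λ : Subgroup G) (p : H →* G) : Γ.comap p × Λ.comap p →* Γ × Λ :=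
  (p.subgroupComap Γ).prodMap (p.subgroupComap Λ)

theorem leftRight_smul_def {K : Type*} [Group K] (A B : Subgroup K) (κ : A × B) (x : K) :
    κ • x = (κ.1 : K) * x * (κ.2 : K)⁻¹ := rfl

theorem map_leftRight_smul (κ : Γ.comap p × Λ.comap p) (x : H) :
    p (κ • x) = comapProdHom Γ Λ p κ • p x := by
  rw [leftRight_smul_def, leftRight_smul_def, map_mul, map_mul, map_inv]
  rfl

variable [MeasurableSpace G] [MeasurableMul₂ G]
  {μ : Measure G} [IsFiniteMeasure μ] [μ.IsMulLeftInvariant]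
  [TopologicalSpace H] [IsTopologicalGroup H]
  [SecondCountableTopology H] [MeasurableSpace H] [BorelSpace H]
  {ν : Measure H} [SFinite ν] [ν.IsMulLeftInvariant] [NeZero ν]
  {Δ : Type*} [Group Δ] [Countable Δ] [MeasurableSpace Δ] [DiscreteMeasurableSpace Δ]
  {F : H → G → Δ}

/-- If the cocycle `F` of `H` intertwines the left translates of `w`, then the coboundary
representing `F` on `H` conjugates the lift of `w` to a cocycle that is invariant under left
translations, hence constant. -/
theorem cohomologousToHom_of_equivariant {w : Γ × Λ → G → Δ} (hw : IsMeasurableCocycle μ w)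
    (hp : Measure.QuasiMeasurePreserving p ν μ) (hF : ∀ s, Measurable (F s))
    (hFmul : ∀ s t, ∀ᵐ x ∂μ, F (s * t) x = F s (p t * x) * F t x)
    (hF1 : ∀ ε : ℝ, 0 < ε → ∀ᶠ s in 𝓝 (1 : H), μ.real {x | F s x ≠ 1} ≤ ε)
    (hFw : ∀ (κ : Γ.comap p × Λ.comap p) (s : H), ∀ᵐ x ∂μ,
      w (comapProdHom Γ Λ p κ) (p s * x) * F s x =
        F (κ.1 * s * (κ.1 : H)⁻¹) (comapProdHom Γ Λ p κ • x) * w (comapProdHom Γ Λ p κ) x) :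
    CohomologousToHom ν (liftCocycle w p) := by
  obtain ⟨ψ, hψ, hψF⟩ := exists_coboundary hp hF hFmul hF1
  set q := comapProdHom Γ Λ p
  have hlift : ∀ κ x, liftCocycle w p κ x = w (q κ) (p x) := fun _ _ => rfl
  have hq : ∀ κ x, p (κ • x) = q κ • p x := map_leftRight_smul
  have hsmul : ∀ κ : Γ.comap p × Λ.comap p, Measurable fun x : H => κ • x := fun κ =>
    (measurable_const_mul (κ.1 : H)).mul_const _
  have hae : ∀ (κ : Γ.comap p × Λ.comap p) {P : H → Prop}, (∀ᵐ x ∂ν, P x) → ∀ᵐ x ∂ν, P (κ • x) :=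
    fun κ P h => ae_mul_left ((ae_mul_right_iff (κ.2 : H)⁻¹).2 h) (κ.1 : H)
  let c : Γ.comap p × Λ.comap p → H → Δ := fun κ x =>
    (ψ (κ • x))⁻¹ * w (q κ) (p x) * ψ x
  have hc : ∀ κ, Measurable (c κ) := fun κ =>
    ((hψ.comp (hsmul κ)).inv.mul ((hw.measurable _).comp hp.measurable)).mul hψ
  have hcinv : ∀ κ s, ∀ᵐ x ∂ν, c κ (s * x) = c κ x := by
    intro κ s
    filter_upwards [hψF s, hae κ (hψF (κ.1 * s * (κ.1 : H)⁻¹)), hp.ae (hFw κ s)] with x h1 h2 h3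
    have h4 : κ • (s * x) = κ.1 * s * (κ.1 : H)⁻¹ * κ • x := by
      simp only [leftRight_smul_def]; group
    simp only [c]
    rw [h4, h2, h1, map_mul, hq, ← mul_assoc, mul_assoc _ (w _ _) (F _ _), h3]
    group
  choose δ hδ using fun κ => exists_ae_eq_const_of_mul_left_invariant (hc κ) (hcinv κ)
  have hδmul : ∀ κ κ', δ (κ * κ') = δ κ * δ κ' := by
    intro κ κ'
    obtain ⟨x, h1, h2, h3, h4⟩ := ((hδ (κ * κ')).and ((hae κ' (hδ κ)).and ((hδ κ').and
      (hp.ae (hw.map_mul (q κ) (q κ')))))).exists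
    rw [← h1, ← h2, ← h3]
    simp only [c]
    rw [map_mul, h4, hq, mul_smul]
    group
  refine ⟨MonoidHom.mk' δ hδmul, ψ, hψ, fun κ => ?_⟩
  filter_upwards [hδ κ] with x hx
  rw [hlift, MonoidHom.mk'_apply, ← hx]
  simp only [c]
  group

end Lift

/-! ### The canonical intertwiners over small elements -/

section Cocycle

variable {G : Type*} [Group G] [MeasurableSpace G] [MeasurableMul G] {μ : Measure G}
  [μ.IsMulLeftInvariant] [μ.IsMulRightInvariant] {Γ Λ : Subgroup G}
  {Δ : Type*} [Group Δ] [MeasurableSpace Δ] {w : Γ × Λ → G → Δ}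

/-- The restriction of a cocycle for the left-right action to the left translations by `Γ`. -/
def leftPart (w : Γ × Λ → G → Δ) (g : Γ) : G → Δ := w (g, 1)

/-- The restriction of a cocycle for the left-right action to the right translations by `Λ`. -/
def rightPart (w : Γ × Λ → G → Δ) (k : Λ) : G → Δ := w (1, k)

omit [MeasurableMul G] [μ.IsMulLeftInvariant] [μ.IsMulRightInvariant] in
theorem IsMeasurableCocycle.leftPart_mul (hw : IsMeasurableCocycle μ w) (g g' : Γ) :
    ∀ᵐ x ∂μ, leftPart w (g * g') x = leftPart w g (g' * x) * leftPart w g' x := by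
  filter_upwards [hw.map_mul (g, 1) (g', 1)] with x hx
  simpa [leftPart, rightPart, leftRight_smul_def] using hx

omit [MeasurableMul G] [μ.IsMulLeftInvariant] [μ.IsMulRightInvariant] in
theorem IsMeasurableCocycle.rightPart_mul (hw : IsMeasurableCocycle μ w) (k k' : Λ) :
    ∀ᵐ x ∂μ, rightPart w (k * k') x =
      rightPart w k (x * (k' : G)⁻¹) * rightPart w k' x := by
  filter_upwards [hw.map_mul (1, k) (1, k')] with x hx
  simpa [leftPart, rightPart, leftRight_smul_def] using hx

omit [MeasurableMul G] [μ.IsMulLeftInvariant] [μ.IsMulRightInvariant] in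
theorem IsMeasurableCocycle.eq_leftPart_mul_rightPart (hw : IsMeasurableCocycle μ w)
    (κ : Γ × Λ) : ∀ᵐ x ∂μ, w κ x = leftPart w κ.1 (x * (κ.2 : G)⁻¹) * rightPart w κ.2 x := by
  filter_upwards [hw.map_mul (κ.1, 1) (1, κ.2)] with x hx
  simpa [leftPart, rightPart, leftRight_smul_def] using hx

omit [MeasurableMul G] [μ.IsMulLeftInvariant] [μ.IsMulRightInvariant] in
theorem IsMeasurableCocycle.isIntertwiner_leftPart (hw : IsMeasurableCocycle μ w) (g : Γ) :
    IsIntertwiner μ (rightPart w) g (leftPart w g) where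
  measurable := hw.measurable _
  map_mul k := by
    filter_upwards [hw.eq_leftPart_mul_rightPart (g, k), hw.map_mul (1, k) (g, 1)] with x h1 h2
    rw [← h1]
    simpa [leftPart, rightPart, leftRight_smul_def] using h2

/-- Equivariance under the left translations extends to the whole left-right action. -/
theorem IsMeasurableCocycle.equivariant_of_leftPart {H : Type*} [Group H] {p : H →* G}
    {F : H → G → Δ} (hw : IsMeasurableCocycle μ w)
    (hF : ∀ s, IsIntertwiner μ (rightPart w) (p s) (F s))
    (hΓ : ∀ (g : Γ.comap p) (s : H), ∀ᵐ x ∂μ,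
      leftPart w (p.subgroupComap Γ g) (p s * x) * F s x =
        F (g * s * (g : H)⁻¹) (p g * x) * leftPart w (p.subgroupComap Γ g) x)
    (κ : Γ.comap p × Λ.comap p) (s : H) : ∀ᵐ x ∂μ,
      w (comapProdHom Γ Λ p κ) (p s * x) * F s x =
        F (κ.1 * s * (κ.1 : H)⁻¹) (comapProdHom Γ Λ p κ • x) *
          w (comapProdHom Γ Λ p κ) x := by
  obtain ⟨g, h⟩ := κ
  set q := comapProdHom Γ Λ p (g, h) with hq
  have h1 := hw.eq_leftPart_mul_rightPart q
  filter_upwards [h1, ae_mul_left h1 (p s), (hF s).map_mul q.2,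
    ae_mul_right (hΓ g s) (q.2 : G)⁻¹] with x h1 h2 h3 h4
  have h5 : q • x = p g * (x * (q.2 : G)⁻¹) := by
    rw [leftRight_smul_def, ← mul_assoc]; rfl
  have h6 : q.1 = p.subgroupComap Γ g := rfl
  rw [← h6, ← mul_assoc (p s)] at h4
  rw [h5, h1, h2, mul_assoc, ← h3, ← mul_assoc, h4, mul_assoc]

end Cocycle

section Canonical

variable {G : Type*} [Group G] [TopologicalSpace G] [IsTopologicalGroup G]
  [SecondCountableTopology G] [MeasurableSpace G] [BorelSpace G]
  {μ : Measure G} [IsProbabilityMeasure μ] [μ.InnerRegular] [μ.IsMulRightInvariant]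
  [μ.IsMulLeftInvariant] {Γ Λ : Subgroup G} {Δ : Type*} [Group Δ] [Countable Δ] [MeasurableSpace Δ]
  [DiscreteMeasurableSpace Δ] {φ : Λ → G → Δ}

open Classical in
/-- An intertwiner over `s` that is trivial outside a set of measure `1 / 8`, if there is one, and
`1` otherwise. The threshold is small enough that it is unique up to null sets and multiplicative
in `s`. -/
noncomputable def nearIntertwiner (μ : Measure G) (φ : Λ → G → Δ) (s : G) : G → Δ :=
  if h : s ∈ nearTrivial μ φ (1 / 8) then h.choose else 1

section

variable {s t : G}

omit [TopologicalSpace G] [IsTopologicalGroup G] [SecondCountableTopology G] [BorelSpace G]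
  [IsProbabilityMeasure μ] [μ.InnerRegular] [μ.IsMulRightInvariant] [μ.IsMulLeftInvariant]
  [Countable Δ] [DiscreteMeasurableSpace Δ] in
theorem isIntertwiner_nearIntertwiner (hs : s ∈ nearTrivial μ φ (1 / 8)) :
    IsIntertwiner μ φ s (nearIntertwiner μ φ s) ∧
      μ.real {x | nearIntertwiner μ φ s x ≠ 1} ≤ 1 / 8 := by
  simp only [nearIntertwiner, dif_pos hs]
  exact hs.choose_spec

theorem nearIntertwiner_mul (hΛ : Dense (Λ : Set G)) (hs : s ∈ nearTrivial μ φ (1 / 8))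
    (ht : t ∈ nearTrivial μ φ (1 / 8)) (hst : s * t ∈ nearTrivial μ φ (1 / 8)) :
    ∀ᵐ x ∂μ, nearIntertwiner μ φ (s * t) x =
      nearIntertwiner μ φ s (t * x) * nearIntertwiner μ φ t x := by
  obtain ⟨h1, h1'⟩ := isIntertwiner_nearIntertwiner hs
  obtain ⟨h2, h2'⟩ := isIntertwiner_nearIntertwiner ht
  obtain ⟨h3, h3'⟩ := isIntertwiner_nearIntertwiner hst
  refine h3.ae_eq_of_near hΛ (h1.mul h2) ?_
  rw [← measureReal_mul_left (fun x => nearIntertwiner μ φ s x ≠ 1) t] at h1'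
  have h4 : μ.real {x | nearIntertwiner μ φ s (t * x) * nearIntertwiner μ φ t x ≠ 1} ≤
      μ.real {x | nearIntertwiner μ φ s (t * x) ≠ 1} +
        μ.real {x | nearIntertwiner μ φ t x ≠ 1} := by
    refine measureReal_setOf_le_add (ae_of_all _ fun x hx => ?_)
    by_contra! hcon
    exact hx (by rw [hcon.1, hcon.2, mul_one])
  linarith

omit [μ.IsMulLeftInvariant] in
theorem measureReal_nearIntertwiner_ne_le (hΛ : Dense (Λ : Set G)) {ε : ℝ} (hε : ε ≤ 1 / 8)
    (hs : s ∈ nearTrivial μ φ ε) : μ.real {x | nearIntertwiner μ φ s x ≠ 1} ≤ ε := by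
  obtain ⟨h1, h1'⟩ := isIntertwiner_nearIntertwiner (nearTrivial_mono hε hs)
  obtain ⟨ψ, h2, h2'⟩ := hs
  refine le_trans (ENNReal.toReal_mono (measure_ne_top _ _) (measure_mono_ae ?_)) h2'
  filter_upwards [h1.ae_eq_of_near hΛ h2 (by linarith)] with x hx hne h
  exact hne (hx.trans h)

omit [μ.IsMulLeftInvariant] in
theorem eventually_nearIntertwiner (hΛ : Dense (Λ : Set G))
    (hnear : ∀ ε : ℝ, 0 < ε → nearTrivial μ φ ε ∈ 𝓝 1) {ε : ℝ} (hε : 0 < ε) :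
    ∀ᶠ s in 𝓝 (1 : G), μ.real {x | nearIntertwiner μ φ s x ≠ 1} ≤ ε := by
  filter_upwards [hnear (min ε (1 / 8)) (lt_min hε (by norm_num))] with s hs
  exact (measureReal_nearIntertwiner_ne_le hΛ (min_le_right _ _) hs).trans (min_le_left _ _)

/-- Conjugating the canonical intertwiner over a small element `s` by the left part of the cocycle
at `g` gives the canonical intertwiner over `g * s * g⁻¹`, when `s` is small compared with `g`. -/
theorem leftPart_mul_nearIntertwiner {w : Γ × Λ → G → Δ} (hΛ : Dense (Λ : Set G))
    (hw : IsMeasurableCocycle μ w) (g : Γ) (hs : s ∈ nearTrivial μ (rightPart w) (1 / 8))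
    (hgs : g * s * (g : G)⁻¹ ∈ nearTrivial μ (rightPart w) (1 / 8))
    (hv : μ.real {x | leftPart w g (s * x) ≠ leftPart w g x} < 1 / 8) :
    ∀ᵐ x ∂μ, leftPart w g (s * x) * nearIntertwiner μ (rightPart w) s x =
      nearIntertwiner μ (rightPart w) (g * s * (g : G)⁻¹) (g * x) * leftPart w g x := by
  obtain ⟨h1, h1'⟩ := isIntertwiner_nearIntertwiner hs
  obtain ⟨h2, h2'⟩ := isIntertwiner_nearIntertwiner hgs
  have h3 := (hw.isIntertwiner_leftPart g).mul h1
  have h4 := h2.mul (hw.isIntertwiner_leftPart g)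
  rw [inv_mul_cancel_right] at h4
  refine h3.ae_eq hΛ h4 ?_
  rw [← measureReal_mul_left
    (fun x => nearIntertwiner μ (rightPart w) (g * s * (g : G)⁻¹) x ≠ 1) g] at h2'
  set a := nearIntertwiner μ (rightPart w) s
  set b := nearIntertwiner μ (rightPart w) (g * s * (g : G)⁻¹)
  have h5 : μ.real {x | leftPart w g (s * x) * a x ≠ b (g * x) * leftPart w g x} ≤
      μ.real {x | leftPart w g (s * x) ≠ leftPart w g x} +
        μ.real {x | a x ≠ 1 ∨ b (g * x) ≠ 1} := by
    refine measureReal_setOf_le_add (ae_of_all _ fun x hx => ?_)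
    by_contra! hcon
    exact hx (by rw [hcon.1, hcon.2.1, hcon.2.2, mul_one, one_mul])
  have h6 : μ.real {x | a x ≠ 1 ∨ b (g * x) ≠ 1} ≤ μ.real {x | a x ≠ 1} +
      μ.real {x | b (g * x) ≠ 1} := measureReal_setOf_le_add (ae_of_all _ fun x hx => hx)
  linarith

end

omit [SecondCountableTopology G] [IsProbabilityMeasure μ] [μ.InnerRegular] [Countable Δ]
  [DiscreteMeasurableSpace Δ] [μ.IsMulRightInvariant] in
/-- The equivariance under conjugation by `g` of a family of maps indexed by a normal subgroup is
multiplicative in `g`, so it suffices to check it on generators of `Γ`. -/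
theorem leftPart_equivariant_of_closure {w : Γ × Λ → G → Δ} (hw : IsMeasurableCocycle μ w)
    {F : G → G → Δ} {N : Subgroup G} [hN : N.Normal] {S : Set Γ} (hS : Subgroup.closure S = ⊤)
    (h : ∀ g ∈ S, ∀ s ∈ N, ∀ᵐ x ∂μ, leftPart w g (s * x) * F s x =
      F (g * s * (g : G)⁻¹) (g * x) * leftPart w g x) (g : Γ) :
    ∀ s ∈ N, ∀ᵐ x ∂μ, leftPart w g (s * x) * F s x =
      F (g * s * (g : G)⁻¹) (g * x) * leftPart w g x := by
  have hone : ∀ᵐ x ∂μ, leftPart w 1 x = 1 := by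
    filter_upwards [hw.leftPart_mul 1 1] with x hx
    simpa using hx
  have hg : g ∈ Subgroup.closure S := hS ▸ Subgroup.mem_top g
  induction hg using Subgroup.closure_induction with
  | mem g hg => exact h g hg
  | one =>
    intro s _
    filter_upwards [hone, ae_mul_left hone s] with x h1 h2
    simp [h1, h2]
  | mul g g' _ _ hg hg' =>
    intro s hs
    have h1 := hw.leftPart_mul g g'
    filter_upwards [h1, ae_mul_left h1 s, hg' s hs,
      ae_mul_left (hg _ (hN.conj_mem s hs g')) g'] with x h1 h2 h3 h4
    have h5 : (g' : G) * s * (g' : G)⁻¹ * (g' * x) = g' * (s * x) := by group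
    have h6 : ((g * g' : Γ) : G) * s * ((g * g' : Γ) : G)⁻¹ =
        g * (g' * s * (g' : G)⁻¹) * (g : G)⁻¹ := by push_cast; group
    rw [h5] at h4
    rw [h1, h2, mul_assoc, h3, ← mul_assoc, h4, h6, mul_assoc, Subgroup.coe_mul,
      mul_assoc (g : G) g' x]
  | inv g _ hg =>
    intro s hs
    have h0 : ∀ᵐ x ∂μ, leftPart w g⁻¹ x = (leftPart w g ((g : G)⁻¹ * x))⁻¹ := by
      filter_upwards [hw.leftPart_mul g g⁻¹, hone] with x h1 h2
      rw [mul_inv_cancel, h2] at h1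
      exact (inv_eq_of_mul_eq_one_right h1.symm).symm
    have h' := hg _ (hN.conj_mem s hs (g : G)⁻¹)
    filter_upwards [h0, ae_mul_left h0 s, ae_mul_left h' (g : G)⁻¹] with x h1 h2 h3
    have h5 : (g : G)⁻¹ * s * ((g : G)⁻¹)⁻¹ * ((g : G)⁻¹ * x) = (g : G)⁻¹ * (s * x) := by group
    have h6 : (g : G) * ((g : G)⁻¹ * s * ((g : G)⁻¹)⁻¹) * (g : G)⁻¹ = s := by group
    rw [h5, h6, mul_inv_cancel_left] at h3
    rw [h1, h2, inv_mul_eq_iff_eq_mul, Subgroup.coe_inv, ← mul_assoc, h3, mul_inv_cancel_right]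

end Canonical

/-! ### The profinite case -/

section Profinite

/-- The profinite case: on a small open normal subgroup the canonical intertwiners form a cocycle,
and equivariance under the finitely many generators of `Γ` needs only finitely many smallness
conditions. -/
theorem exists_open_subgroup_cohomologousToHom {G : Type*} [Group G] [TopologicalSpace G]
    [IsTopologicalGroup G] [CompactSpace G] [PolishSpace G] [TotallyDisconnectedSpace G]
    [MeasurableSpace G] [BorelSpace G] {μ : Measure G} [μ.IsHaarMeasure] [IsProbabilityMeasure μ]
    [μ.IsMulRightInvariant] {Γ Λ : Subgroup G} (hΛ : Dense (Λ : Set G)) (hΓ : Γ.FG)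
    {Δ : Type*} [Group Δ] [Countable Δ] [MeasurableSpace Δ] [DiscreteMeasurableSpace Δ]
    {w : Γ × Λ → G → Δ} (hw : IsMeasurableCocycle μ w)
    (hnear : ∀ ε : ℝ, 0 < ε → nearTrivial μ (rightPart w) ε ∈ 𝓝 1) :
    ∃ G₀ : Subgroup G, IsOpen (G₀ : Set G) ∧
      CohomologousToHom (μ.comap ((↑) : G₀ → G)) (restrictCocycle w G₀) := by
  obtain ⟨S, hS⟩ := (Group.fg_iff_subgroup_fg Γ).2 hΓ
  have hU : ∀ᶠ s in 𝓝 (1 : G), s ∈ nearTrivial μ (rightPart w) (1 / 8) ∧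
      ∀ g ∈ S, μ.real {x | leftPart w g (s * x) ≠ leftPart w g x} < 1 / 8 :=
    Filter.Eventually.and (hnear (1 / 8) (by norm_num)) ((S.eventually_all).2 fun g _ =>
      eventually_measureReal_mul_left_ne (hw.measurable _) (by norm_num))
  obtain ⟨U, hUsub, hUo, h1U⟩ := eventually_nhds_iff.1 hU
  obtain ⟨N, hN⟩ := ProfiniteGrp.exist_openNormalSubgroup_sub_open_nhds_of_one hUo h1U
  have hsub : ∀ s ∈ N.toSubgroup, s ∈ nearTrivial μ (rightPart w) (1 / 8) ∧
      ∀ g ∈ S, μ.real {x | leftPart w g (s * x) ≠ leftPart w g x} < 1 / 8 :=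
    fun s hs => hUsub s (hN hs)
  have hNo : IsOpen (N.toSubgroup : Set G) := N.isOpen'
  set G₀ := N.toSubgroup
  have hNn : G₀.Normal := N.isNormal'
  refine ⟨G₀, hNo, ?_⟩
  have hemb : IsOpenEmbedding G₀.subtype := hNo.isOpenEmbedding_subtypeVal
  have : SecondCountableTopology G₀ :=
    TopologicalSpace.Subtype.secondCountableTopology (G₀ : Set G)
  have : CompactSpace G₀ := isCompact_iff_compactSpace.1 (G₀.isClosed_of_isOpen hNo).isCompact
  have : (μ.comap ((↑) : G₀ → G)).IsHaarMeasure :=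
    Measure.IsHaarMeasure.comap (mH := inferInstance) μ hemb
  have hp : Measure.QuasiMeasurePreserving G₀.subtype (μ.comap ((↑) : G₀ → G)) μ := by
    refine quasiMeasurePreserving_of_range_ne_zero measurable_subtype_coe ?_
    rw [Subgroup.coe_subtype, Subtype.range_coe]
    exact (hNo.measure_pos μ ⟨1, G₀.one_mem⟩).ne'
  have hF : ∀ s : G₀, IsIntertwiner μ (rightPart w) s (nearIntertwiner μ (rightPart w) s) :=
    fun s => (isIntertwiner_nearIntertwiner (hsub s s.2).1).1
  refine cohomologousToHom_of_equivariant (p := G₀.subtype)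
    (F := fun s => nearIntertwiner μ (rightPart w) s) hw hp
    (fun s => (hF s).measurable)
    (fun s t => nearIntertwiner_mul hΛ (hsub s s.2).1 (hsub t t.2).1 (hsub _ (s * t).2).1)
    (fun ε hε => (continuous_subtype_val.tendsto (1 : G₀)).eventually
      (eventually_nearIntertwiner hΛ hnear hε))
    (hw.equivariant_of_leftPart hF fun g s => ?_)
  exact leftPart_equivariant_of_closure hw hS
    (fun g hg s hs => leftPart_mul_nearIntertwiner hΛ hw g (hsub s hs).1
      (hsub _ (hNn.conj_mem s hs g)).1 ((hsub s hs).2 g hg))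
    (G₀.subtype.subgroupComap Γ g) s s.2

end Profinite

/-! ### Extending local homomorphisms on simply connected groups -/

section Monodromy

variable {H A : Type*} [Group H] [TopologicalSpace H] [IsTopologicalGroup H] [Group A]

/-- The flat bundle with discrete fibre `A` attached to a local homomorphism `f` near `1`: in the
chart around `i` the vector over `x` with global value `a` has coordinate `a * (f (i⁻¹ * x))⁻¹`. -/
def localHomBundle [TopologicalSpace A] [DiscreteTopology A] {U W : Set H} {f : H → A}
    (hf : ∀ s ∈ U, ∀ t ∈ U, s * t ∈ U → f (s * t) = f s * f t) (hWo : IsOpen W)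
    (h1W : 1 ∈ W) (hWU : W ⊆ U) (hWW : ∀ s ∈ W, ∀ t ∈ W, s * t⁻¹ ∈ U) :
    FiberBundleCore H H A where
  baseSet i := {x | i⁻¹ * x ∈ W}
  isOpen_baseSet i := hWo.preimage (continuous_const_mul i⁻¹)
  indexAt x := x
  mem_baseSet_at x := by simpa
  coordChange i j x a := a * (f (i⁻¹ * x) * (f (j⁻¹ * x))⁻¹)
  coordChange_self i x _ a := by simp
  continuousOn_coordChange i j := by
    have h : ContinuousOn (fun z : H × A => z.2 * f (i⁻¹ * j))
        (({x | i⁻¹ * x ∈ W} ∩ {x | j⁻¹ * x ∈ W}) ×ˢ Set.univ) :=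
      ((continuous_of_discreteTopology (f := fun a : A => a * f (i⁻¹ * j))).comp
        continuous_snd).continuousOn
    refine h.congr fun z hz => ?_
    have hi : i⁻¹ * z.1 ∈ W := hz.1.1
    have hj : j⁻¹ * z.1 ∈ W := hz.1.2
    have hij : i⁻¹ * z.1 = i⁻¹ * j * (j⁻¹ * z.1) := by group
    have h1 : i⁻¹ * j ∈ U := by simpa [mul_assoc] using hWW _ hi _ hj
    have h2 := hf _ h1 _ (hWU hj) (by rw [← hij]; exact hWU hi)
    simp only
    rw [hij, h2, mul_inv_cancel_right]
  coordChange_comp i j k x _ a := by group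

/-- A map on a simply connected, locally path connected group that is multiplicative near `1`
agrees near `1` with a homomorphism. -/
theorem exists_monoidHom_eventuallyEq [SimplyConnectedSpace H] [LocallyPathConnectedSpace H]
    {U : Set H} (hU : U ∈ 𝓝 1) {f : H → A}
    (hf : ∀ s ∈ U, ∀ t ∈ U, s * t ∈ U → f (s * t) = f s * f t) :
    ∃ σ : H →* A, ∀ᶠ s in 𝓝 1, σ s = f s := by
  let _ : TopologicalSpace A := ⊥
  have : DiscreteTopology A := ⟨rfl⟩
  obtain ⟨V, hVo, h1V, hV⟩ := exists_open_nhds_one_split hU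
  have h1U : (1 : H) ∈ U := mem_of_mem_nhds hU
  have hf1 : f 1 = 1 := by simpa using hf 1 h1U 1 h1U (by simpa)
  let Z := localHomBundle (W := V ∩ V⁻¹) hf (hVo.inter hVo.inv) ⟨h1V, by simpa⟩
    (fun s hs => by simpa using hV s hs.1 1 h1V)
    (fun s hs t ht => hV s hs.1 t⁻¹ ht.2)
  have hcov : IsCoveringMap (Bundle.TotalSpace.proj : Z.TotalSpace → H) :=
    FiberBundle.isCoveringMap (F := A) (E := Z.Fiber)
  obtain ⟨S, ⟨hS1, hS⟩, -⟩ := hcov.existsUnique_continuousMap_lifts (ContinuousMap.id H) 1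
    ⟨1, (1 : A)⟩ rfl
  have hproj : ∀ x, (S x).proj = x := fun x => congrFun hS x
  -- the value of the section, read in the chart centred at its base point
  let g : H → A := fun x => (S x).snd
  have hloc : ∀ i, ∀ᶠ x in 𝓝 i, g x = g i * f (i⁻¹ * x) := by
    intro i
    let c : H → A := fun x => (Z.localTriv i (S x)).2
    have hc : ∀ x, c x = g x * (f (i⁻¹ * x))⁻¹ := fun x => by
      have h1 : c x = g x * (f ((S x).proj⁻¹ * (S x).proj) * (f (i⁻¹ * (S x).proj))⁻¹) := by
        simp only [c, Z.localTriv_apply]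
        rfl
      rw [h1, hproj, inv_mul_cancel, hf1, one_mul]
    have hcont : ContinuousAt c i := by
      have h1 : S i ∈ (Z.localTriv i).source := by
        rw [Z.mem_localTriv_source, hproj]
        exact Z.mem_baseSet_at i
      exact continuous_snd.continuousAt.comp
        (((Z.localTriv i).continuousAt h1).comp S.continuous.continuousAt)
    have hci : c i = g i := by rw [hc, inv_mul_cancel, hf1, inv_one, mul_one]
    have h1 : ∀ᶠ x in 𝓝 i, c x = c i := by
      have h2 : ({c i} : Set A) ∈ 𝓝 (c i) := by simp [nhds_discrete]
      exact hcont.eventually h2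
    filter_upwards [h1] with x hx
    rw [← hci, ← hx, hc, inv_mul_cancel_right]
  have hg1 : g 1 = 1 := by
    simp only [g]
    rw [hS1]
  have hgmul : ∀ y x, g (y * x) = g y * g x := by
    intro y
    have hlc : IsLocallyConstant fun x => g (y * x) * (g x)⁻¹ := by
      rw [IsLocallyConstant.iff_eventually_eq]
      intro i
      have h1 : Tendsto (fun x => y * x) (𝓝 i) (𝓝 (y * i)) :=
        (continuous_const_mul y).tendsto i
      filter_upwards [hloc i, h1.eventually (hloc (y * i))] with x hx hyx
      rw [hx, hyx]
      have h2 : (y * i)⁻¹ * (y * x) = i⁻¹ * x := by group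
      rw [h2]
      group
    intro x
    have h3 := hlc.apply_eq_of_isPreconnected isPreconnected_univ (Set.mem_univ x)
      (Set.mem_univ 1)
    simp only [mul_one, hg1, inv_one] at h3
    rw [← h3, inv_mul_cancel_right]
  refine ⟨MonoidHom.mk' g hgmul, ?_⟩
  filter_upwards [hloc 1] with s hs
  simpa [hg1] using hs

end Monodromy

/-! ### Topology of the covering group -/

section Covering

/-- A locally compact Hausdorff group with a continuous homomorphism with discrete kernel to a
first countable Hausdorff group is first countable at `1`: the homomorphism embeds a compact
neighbourhood of `1`. -/
theorem isCountablyGenerated_nhds_one_of_discrete_ker {G H : Type*} [Group G] [TopologicalSpace G]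
    [T2Space G] [FirstCountableTopology G] [Group H] [TopologicalSpace H]
    [IsTopologicalGroup H] [LocallyCompactSpace H] {p : H →* G} (hp : Continuous p)
    (hker : DiscreteTopology p.ker) : (𝓝 (1 : H)).IsCountablyGenerated := by
  obtain ⟨U, hU, hUker⟩ : ∃ U ∈ 𝓝 (1 : H), ∀ x ∈ U, p x = 1 → x = 1 := by
    have h1 : ({1} : Set p.ker) ∈ 𝓝 (1 : p.ker) := by simp
    obtain ⟨U, hU, hsub⟩ := mem_nhds_subtype _ _ _ |>.1 h1
    exact ⟨U, hU, fun x hx hpx => congrArg Subtype.val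
      (show (⟨x, hpx⟩ : p.ker) = 1 from hsub hx)⟩
  obtain ⟨V, hVo, h1V, hV⟩ := exists_open_nhds_one_split hU
  obtain ⟨K, hK, hKsub, hKc⟩ := local_compact_nhds
    ((hVo.inter hVo.inv).mem_nhds (⟨h1V, by simpa⟩ : (1 : H) ∈ V ∩ V⁻¹))
  have : CompactSpace K := isCompact_iff_compactSpace.1 hKc
  have hinj : Function.Injective fun x : K => p x := by
    intro x y hxy
    have h2 : (x : H) * (y : H)⁻¹ = 1 := hUker _ (hV _ (hKsub x.2).1 _ (hKsub y.2).2)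
      (by rw [map_mul, map_inv, show p x = p y from hxy, mul_inv_cancel])
    exact Subtype.ext (mul_inv_eq_one.1 h2)
  have hemb := (hp.comp continuous_subtype_val).isClosedEmbedding hinj
  have h3 : (𝓝 (⟨1, mem_of_mem_nhds hK⟩ : K)).IsCountablyGenerated := by
    rw [hemb.isInducing.nhds_eq_comap]
    infer_instance
  rw [← map_nhds_subtype_coe_eq_nhds (mem_of_mem_nhds hK) hK]
  infer_instance

/-- A connected locally compact group is generated by a compact neighbourhood of `1`, hence is
`σ`-compact. -/
theorem sigmaCompactSpace_of_connected {H : Type*} [Group H] [TopologicalSpace H]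
    [IsTopologicalGroup H] [LocallyCompactSpace H] [PreconnectedSpace H] : SigmaCompactSpace H := by
  open Pointwise in
  obtain ⟨K, hKc, hK⟩ := exists_compact_mem_nhds (1 : H)
  have hLc : IsCompact (K ∪ K⁻¹) := hKc.union hKc.inv
  have hLn : ∀ n : ℕ, IsCompact ((K ∪ K⁻¹) ^ n) := fun n => by
    induction n with
    | zero => simp
    | succ n ih => rw [pow_succ]; exact ih.mul hLc
  have hnhds : ∀ x : H, (fun k => x * k) '' K ∈ 𝓝 x := fun x => by
    simpa using (Homeomorph.mulLeft x).isOpenMap.image_mem_nhds hK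
  have hclopen : IsClopen (⋃ n : ℕ, (K ∪ K⁻¹) ^ n) := by
    constructor
    · rw [← isOpen_compl_iff, isOpen_iff_mem_nhds]
      intro x hx
      filter_upwards [hnhds x]
      rintro _ ⟨k, hk, rfl⟩ hmem
      obtain ⟨n, hn⟩ := Set.mem_iUnion.1 hmem
      refine hx (Set.mem_iUnion.2 ⟨n + 1, ?_⟩)
      rw [pow_succ]
      exact ⟨_, hn, k⁻¹, Or.inr (by simpa), by simp⟩
    · rw [isOpen_iff_mem_nhds]
      intro x hx
      obtain ⟨n, hn⟩ := Set.mem_iUnion.1 hx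
      filter_upwards [hnhds x]
      rintro _ ⟨k, hk, rfl⟩
      refine Set.mem_iUnion.2 ⟨n + 1, ?_⟩
      rw [pow_succ]
      exact ⟨_, hn, k, Or.inl hk, rfl⟩
  refine ⟨fun n => (K ∪ K⁻¹) ^ n, hLn, hclopen.eq_univ ⟨1, Set.mem_iUnion.2 ⟨0, by simp⟩⟩⟩

theorem secondCountableTopology_of_isCountablyGenerated {H : Type*} [Group H] [TopologicalSpace H]
    [IsTopologicalGroup H] [SigmaCompactSpace H] (h : (𝓝 (1 : H)).IsCountablyGenerated) :
    SecondCountableTopology H := by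
  let _ := IsTopologicalGroup.rightUniformSpace H
  have : (uniformity H).IsCountablyGenerated := by
    change (comap _ (𝓝 (1 : H))).IsCountablyGenerated
    infer_instance
  let _ := UniformSpace.pseudoMetricSpace H
  infer_instance

end Covering

/-! ### Local path connectedness -/

section LocallyPathConnected

/-- A continuous half-line that converges at infinity can be reparametrized to a path. -/
theorem joinedIn_of_tendsto {X : Type*} [TopologicalSpace X] {f : ℝ → X} {x : X} {U : Set X}
    (hf : Continuous f) (hlim : Tendsto f atTop (𝓝 x)) (hU : ∀ t, f t ∈ U) (hx : x ∈ U) :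
    JoinedIn U (f 0) x := by
  let h : ℝ → X := fun t => if t < 1 then f (t / (1 - t)) else x
  have h_lt : ∀ t < 1, h t = f (t / (1 - t)) := fun t ht => if_pos ht
  have h_one : h 1 = x := if_neg (lt_irrefl 1)
  refine JoinedIn.ofLine (f := h) (fun t ht => ?_) (by simp [h]) h_one ?_
  · rcases ht.2.lt_or_eq with hlt | rfl
    · have h1 : ContinuousAt (fun t : ℝ => f (t / (1 - t))) t := by
        refine hf.continuousAt.comp (ContinuousAt.div₀ continuousAt_id (by fun_prop) ?_)
        linarith
      refine (h1.congr ?_).continuousWithinAt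
      filter_upwards [Iio_mem_nhds hlt] with s hs using (h_lt s hs).symm
    · have hlim' : Tendsto h (𝓝[<] 1) (𝓝 x) := by
        have h2 : Tendsto (fun t : ℝ => t / (1 - t)) (𝓝[<] 1) atTop := by
          have h3 : Tendsto (fun t : ℝ => 1 - t) (𝓝[<] 1) (𝓝[>] 0) := by
            refine tendsto_nhdsWithin_iff.2 ⟨?_, ?_⟩
            · have : Tendsto (fun t : ℝ => 1 - t) (𝓝 1) (𝓝 (1 - 1)) := by
                exact (continuous_const.sub continuous_id).tendsto 1
              rw [sub_self] at this
              exact this.mono_left nhdsWithin_le_nhds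
            · filter_upwards [self_mem_nhdsWithin] with t ht
              exact sub_pos.2 (show t < 1 from ht)
          simp only [div_eq_mul_inv]
          exact Tendsto.pos_mul_atTop one_pos (tendsto_id.mono_left nhdsWithin_le_nhds)
            (tendsto_inv_nhdsGT_zero.comp h3)
        refine (hlim.comp h2).congr' ?_
        filter_upwards [self_mem_nhdsWithin] with t ht using (h_lt t ht).symm
      have h4 : ContinuousWithinAt h (insert 1 (Set.Iio 1)) 1 := by
        rw [continuousWithinAt_insert_self]
        change Tendsto h (𝓝[<] 1) (𝓝 (h 1))
        rwa [h_one]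
      exact h4.mono fun s hs => hs.2.eq_or_lt
  · rintro _ ⟨t, ht, rfl⟩
    by_cases h1 : t < 1
    · rw [h_lt t h1]; exact hU _
    · simpa only [h, if_neg h1] using hx

variable {H : Type*} [Group H] [TopologicalSpace H] [IsTopologicalGroup H]

/-- Baire's theorem makes the elements joined to `1` inside `U` dense in a neighbourhood of `1`:
countably many sets of uniformly close paths cover the path space. -/
theorem closure_pathComponentIn_mem_nhds [SecondCountableTopology H] [BaireSpace H]
    [PathConnectedSpace H] {U : Set H} (hU : U ∈ 𝓝 1) :
    closure (pathComponentIn U 1) ∈ 𝓝 (1 : H) := by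
  obtain ⟨V, hVo, h1V, hV⟩ := exists_open_nhds_one_split hU
  set W := V ∩ V⁻¹ with hW
  have hWo : IsOpen W := hVo.inter hVo.inv
  let O : C(unitInterval, H) → Set C(unitInterval, H) := fun γ => {γ' | ∀ t, (γ t)⁻¹ * γ' t ∈ W}
  have hO : ∀ γ, O γ ∈ 𝓝 γ := by
    intro γ
    have h1 : IsOpen {f : C(unitInterval, H) | Set.MapsTo f Set.univ W} :=
      ContinuousMap.isOpen_setOfPred_mapsTo isCompact_univ hWo
    have h2 : Continuous fun γ' : C(unitInterval, H) => γ⁻¹ * γ' := continuous_const_mul _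
    refine mem_of_superset ((h1.preimage h2).mem_nhds fun t _ => ?_) fun γ' hγ' t =>
      hγ' (Set.mem_univ t)
    simp [hW, h1V]
  obtain ⟨S, hS, hSc⟩ := TopologicalSpace.countable_cover_nhds hO
  let E : C(unitInterval, H) → Set H := fun γ => {y | ∃ γ' ∈ O γ, γ' 0 = 1 ∧ γ' 1 = y}
  have hEU : ∀ γ, ∀ y ∈ E γ, ∀ y' ∈ E γ, y⁻¹ * y' ∈ pathComponentIn U 1 := by
    rintro γ _ ⟨γ₁, h1, h10, rfl⟩ _ ⟨γ₂, h2, h20, rfl⟩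
    refine ⟨⟨γ₁⁻¹ * γ₂, by simp [h10, h20], by simp⟩, fun t => ?_⟩
    change (γ₁ t)⁻¹ * γ₂ t ∈ U
    have h3 : (γ₁ t)⁻¹ * γ₂ t = ((γ t)⁻¹ * γ₁ t)⁻¹ * ((γ t)⁻¹ * γ₂ t) := by group
    rw [h3]
    exact hV _ (h1 t).2 _ (h2 t).1
  have := hS.to_subtype
  have hcover : ⋃ γ : S, closure (E γ) = Set.univ := by
    refine Set.eq_univ_of_forall fun y => ?_
    obtain ⟨γ'⟩ := PathConnectedSpace.joined (1 : H) y
    have h1 : γ'.toContinuousMap ∈ ⋃ γ ∈ S, O γ := hSc ▸ Set.mem_univ _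
    simp only [Set.mem_iUnion] at h1 ⊢
    obtain ⟨γ, hγ, h2⟩ := h1
    exact ⟨⟨γ, hγ⟩, subset_closure ⟨_, h2, γ'.source, γ'.target⟩⟩
  obtain ⟨⟨γ, _⟩, z, hz⟩ := nonempty_interior_of_iUnion_of_closed
    (fun _ => isClosed_closure) hcover
  have hz' : closure (E γ) ∈ 𝓝 z := mem_interior_iff_mem_nhds.1 hz
  have h5 : Tendsto (fun x => z * x) (𝓝 1) (𝓝 z) := by
    simpa using (continuous_const_mul z).tendsto 1
  filter_upwards [h5 hz'] with x hx
  have hzE : z ∈ closure (E γ) := interior_subset hz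
  have h6 := map_mem_closure₂ (f := fun a b : H => a⁻¹ * b) (by fun_prop) hzE hx
    (hEU γ)
  simpa using h6

omit [TopologicalSpace H] [IsTopologicalGroup H] in
theorem prod_map_range'_mem {u : ℕ → Set H} (h1 : ∀ n, 1 ∈ u n)
    (hu : ∀ n, ∀ a ∈ u (n + 1), ∀ b ∈ u (n + 1), a * b ∈ u n) {c : ℕ → H}
    (hc : ∀ n, c n ∈ u (n + 1)) (k n : ℕ) : ((List.range' n k).map c).prod ∈ u n := by
  induction k generalizing n with
  | zero => simpa using h1 n
  | succ k ih =>
    rw [List.range'_succ, List.map_cons, List.prod_cons]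
    exact hu n _ (hc n) _ (ih (n + 1))

/-- An element in the closure of a small path component of `1` is an infinite product of elements
joined to `1` inside shrinking neighbourhoods; running through these paths one after another
joins it to `1`. -/
theorem closure_pathComponentIn_subset {u : ℕ → Set H} (hbasis : (𝓝 (1 : H)).HasAntitoneBasis u)
    (hu : ∀ n, ∀ a ∈ u (n + 1), ∀ b ∈ u (n + 1), a * b ∈ u n)
    (hclos : ∀ n, closure (pathComponentIn (u n) 1) ∈ 𝓝 (1 : H)) :
    closure (pathComponentIn (u 1) 1) ⊆ pathComponentIn (u 0) 1 := by
  intro x hx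
  have hun : ∀ n, u n ∈ 𝓝 (1 : H) := hbasis.mem
  have h1u : ∀ n, 1 ∈ u n := fun n => mem_of_mem_nhds (hun n)
  have hnhds : ∀ {z : H} {V : Set H}, V ∈ 𝓝 1 → {y | y⁻¹ * z ∈ V} ∈ 𝓝 z := fun {z V} hV => by
    have h : ContinuousAt (fun y : H => y⁻¹ * z) z := by fun_prop
    exact h.preimage_mem_nhds (by simpa using hV)
  have hclu : ∀ n, closure (pathComponentIn (u (n + 1)) 1) ⊆ u n := fun n z hz => by
    obtain ⟨y, hy, hyu⟩ := mem_closure_iff_nhds.1 hz _ (hnhds (hun (n + 1)))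
    have h := hu n y (pathComponentIn_subset hyu) _ hy
    rwa [mul_inv_cancel_left] at h
  have hstep : ∀ n, ∀ z ∈ closure (pathComponentIn (u (n + 1)) 1),
      ∃ y ∈ pathComponentIn (u (n + 1)) 1, y⁻¹ * z ∈ closure (pathComponentIn (u (n + 2)) 1) :=
    fun n z hz => by
      obtain ⟨y, hy, hyu⟩ := mem_closure_iff_nhds.1 hz _ (hnhds (hclos (n + 2)))
      exact ⟨y, hyu, hy⟩
  choose! y hy hyz using hstep
  let z : ℕ → H := fun n => Nat.rec x (fun n a => (y n a)⁻¹ * a) n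
  have hz : ∀ n, z n ∈ closure (pathComponentIn (u (n + 1)) 1) := fun n => by
    induction n with
    | zero => exact hx
    | succ n ih => exact hyz n _ ih
  have hyn : ∀ n, JoinedIn (u (n + 1)) 1 (y n (z n)) := fun n => hy n _ (hz n)
  let γ : ℕ → ℝ → H := fun n t => (hyn n).somePath.extend (t - n)
  have hγc : ∀ n, Continuous (γ n) := fun n =>
    (hyn n).somePath.continuous_extend.comp (continuous_id.sub continuous_const)
  have hγu : ∀ n t, γ n t ∈ u (n + 1) := fun n t => by
    have h : γ n t ∈ Set.range (hyn n).somePath := by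
      rw [← Path.extend_range]
      exact Set.mem_range_self _
    obtain ⟨a, ha⟩ := h
    rw [← ha]
    exact (hyn n).somePath_mem a
  have hγ0 : ∀ (n : ℕ) (t : ℝ), t ≤ n → γ n t = 1 := fun n t ht =>
    Path.extend_of_le_zero _ (by linarith)
  have hγ1 : ∀ (n : ℕ) (t : ℝ), n + 1 ≤ t → γ n t = y n (z n) := fun n t ht =>
    Path.extend_of_one_le _ (by linarith)
  let Q : ℕ → ℕ → ℝ → H := fun n k t => ((List.range' n k).map fun i => γ i t).prod
  have hQu : ∀ n k t, Q n k t ∈ u n := fun n k t => prod_map_range'_mem h1u hu (hγu · t) k n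
  have hQadd : ∀ n k t, Q 0 (n + k) t = Q 0 n t * Q n k t := fun n k t => by
    simp only [Q]
    rw [← List.range'_append_1, List.map_append, List.prod_append, zero_add]
  have hQ1 : ∀ (n k : ℕ) (t : ℝ), t ≤ n → Q n k t = 1 := fun n k t ht => by
    refine List.prod_eq_one fun a ha => ?_
    obtain ⟨i, hi, rfl⟩ := List.mem_map.1 ha
    exact hγ0 i t (ht.trans (by exact_mod_cast (List.mem_range'_1.1 hi).1))
  have hQz : ∀ (n : ℕ) (t : ℝ), n ≤ t → Q 0 n t * z n = x := fun n => by
    induction n with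
    | zero => intro t _; simp [Q, z]
    | succ n ih =>
      intro t ht
      push_cast at ht
      have h2 : z (n + 1) = (y n (z n))⁻¹ * z n := rfl
      have h3 : Q n 1 t = γ n t := by simp [Q]
      rw [hQadd, h3, hγ1 n t ht, h2, mul_assoc, mul_inv_cancel_left]
      exact ih t (by linarith)
  let Φ : ℝ → H := fun t => Q 0 ⌈t⌉₊ t
  have hΦ : ∀ (n : ℕ) (t : ℝ), t ≤ n → Φ t = Q 0 n t := fun n t ht => by
    obtain ⟨k, hk⟩ := Nat.exists_eq_add_of_le (Nat.ceil_le.2 ht)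
    rw [hk, hQadd, hQ1 _ _ _ (Nat.le_ceil t), mul_one]
  have hΦc : Continuous Φ := by
    rw [continuous_iff_continuousAt]
    intro t
    obtain ⟨n, hn⟩ := exists_nat_gt t
    have h : Continuous (Q 0 n) := continuous_list_prod _ fun i _ => hγc i
    refine h.continuousAt.congr ?_
    filter_upwards [Iio_mem_nhds hn] with s hs using (hΦ n s (le_of_lt hs)).symm
  have hlim : Tendsto Φ atTop (𝓝 x) := by
    have h1 : Tendsto (fun t => x⁻¹ * Φ t) atTop (𝓝 1) := by
      intro V hV
      have h2 : Tendsto (fun q : H × H => q.1⁻¹ * q.2) (𝓝 1 ×ˢ 𝓝 1) (𝓝 1) := by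
        rw [← nhds_prod_eq]
        have : Continuous fun q : H × H => q.1⁻¹ * q.2 := by fun_prop
        simpa using this.tendsto (1, 1)
      obtain ⟨n, -, hn⟩ := (hbasis.toHasBasis.prod_self).mem_iff.1 (h2 hV)
      change ∀ᶠ t in atTop, x⁻¹ * Φ t ∈ V
      filter_upwards [eventually_ge_atTop (n : ℝ)] with t ht
      obtain ⟨k, hk⟩ := exists_nat_ge t
      obtain ⟨m, rfl⟩ := Nat.exists_eq_add_of_le (show n ≤ k by exact_mod_cast ht.trans hk)
      have h3 : x⁻¹ * Φ t = (z n)⁻¹ * Q n m t := by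
        rw [hΦ _ t hk, hQadd, ← hQz n t ht]
        group
      rw [h3]
      exact hn (Set.mk_mem_prod (hclu n (hz n)) (hQu n m t))
    simpa using h1.const_mul x
  have hΦ0 : Φ 0 = 1 := by simp [Φ, Q]
  have h := joinedIn_of_tendsto hΦc hlim (fun t => hQu 0 _ t) (hclu 0 hx)
  rwa [hΦ0] at h

/-- A path connected second countable Baire group is locally path connected. -/
theorem locallyPathConnectedSpace_of_pathConnected [SecondCountableTopology H] [BaireSpace H]
    [PathConnectedSpace H] : LocallyPathConnectedSpace H := by
  have h1 : ∀ U ∈ 𝓝 (1 : H), pathComponentIn U 1 ∈ 𝓝 (1 : H) := by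
    intro U hU
    obtain ⟨u, hbasis, hu⟩ := IsTopologicalGroup.exists_antitone_basis_nhds_one H
    obtain ⟨N, -, hN⟩ := hbasis.toHasBasis.mem_iff.1 hU
    have hbasis' : (𝓝 (1 : H)).HasAntitoneBasis fun n => u (N + n) :=
      hbasis.comp_strictMono (strictMono_id.const_add N)
    refine mem_of_superset (closure_pathComponentIn_mem_nhds (hbasis'.mem 1)) ?_
    exact (closure_pathComponentIn_subset hbasis'
      (fun n a ha b hb => hu _ (Set.mul_mem_mul ha hb))
      fun n => closure_pathComponentIn_mem_nhds (hbasis'.mem n)).trans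
        fun y hy => JoinedIn.mono hy hN
  rw [locallyPathConnectedSpace_iff_pathComponentIn_mem_nhds]
  intro x U hUo hx
  have h2 : (fun y => x * y) ⁻¹' U ∈ 𝓝 1 :=
    (continuous_const_mul x).continuousAt.preimage_mem_nhds (by simpa using hUo.mem_nhds hx)
  have h3 : Tendsto (fun y => x⁻¹ * y) (𝓝 x) (𝓝 1) := by
    simpa using (continuous_const_mul x⁻¹).tendsto x
  filter_upwards [h3 (h1 _ h2)] with y hy
  have h4 : JoinedIn _ 1 (x⁻¹ * y) := hy
  have h5 := h4.map (f := fun y => x * y) (continuous_const_mul x)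
  simp only [mul_one, mul_inv_cancel_left] at h5
  exact h5.mono (Set.image_preimage_subset _ _)

end LocallyPathConnected

/-! ### Twisted translations -/

section Twist

variable {G : Type*} [Group G] [MeasurableSpace G] [MeasurableMul G] (μ : Measure G)
  [μ.IsMulLeftInvariant] {Δ : Type*} [Group Δ] (s t : G) (ψ ψ' : G → Δ)

/-- The bijection `f ↦ (x ↦ ψ (s⁻¹ * x) * f (s⁻¹ * x))` of the maps `G → Δ` modulo null sets.
These bijections realize the group of pairs `(s, ψ)` with the law
`(s, ψ) (t, ψ') = (s * t, x ↦ ψ (t * x) * ψ' x)`. -/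
def twistedTranslation : Equiv.Perm (Germ (ae μ) Δ) where
  toFun := Quotient.map' (fun f x => ψ (s⁻¹ * x) * f (s⁻¹ * x)) fun f f' h => by
    filter_upwards [ae_mul_left h s⁻¹] with x hx
    rw [hx]
  invFun := Quotient.map' (fun f x => (ψ x)⁻¹ * f (s * x)) fun f f' h => by
    filter_upwards [ae_mul_left h s] with x hx
    rw [hx]
  left_inv f := by
    induction f using Germ.inductionOn with
    | _ f => exact congrArg ((↑) : (G → Δ) → Germ (ae μ) Δ) (funext fun x => by simp)
  right_inv f := by
    induction f using Germ.inductionOn with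
    | _ f => exact congrArg ((↑) : (G → Δ) → Germ (ae μ) Δ) (funext fun x => by simp)

theorem twistedTranslation_coe (f : G → Δ) : twistedTranslation μ s ψ (f : Germ (ae μ) Δ) =
    ((fun x => ψ (s⁻¹ * x) * f (s⁻¹ * x) : G → Δ) : Germ (ae μ) Δ) := rfl

theorem twistedTranslation_mul : twistedTranslation μ s ψ * twistedTranslation μ t ψ' =
    twistedTranslation μ (s * t) fun x => ψ (t * x) * ψ' x := by
  ext f
  induction f using Germ.inductionOn with
  | _ f =>
    simp only [Equiv.Perm.mul_apply, twistedTranslation_coe]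
    congr 1
    ext x
    simp [mul_assoc]

theorem twistedTranslation_inv : (twistedTranslation μ s ψ)⁻¹ =
    twistedTranslation μ s⁻¹ fun x => (ψ (s⁻¹ * x))⁻¹ := by
  rw [inv_eq_iff_mul_eq_one, twistedTranslation_mul]
  ext f
  induction f using Germ.inductionOn with
  | _ f =>
    rw [twistedTranslation_coe]
    simp

variable {μ s ψ ψ'}

theorem twistedTranslation_eq_iff :
    twistedTranslation μ s ψ = twistedTranslation μ s ψ' ↔ ψ =ᵐ[μ] ψ' := by
  constructor
  · intro h
    have h1 := Germ.coe_eq.1 (Equiv.congr_fun h ((1 : G → Δ) : Germ (ae μ) Δ))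
    filter_upwards [ae_mul_left h1 s] with x hx
    simpa using hx
  · intro h
    ext f
    induction f using Germ.inductionOn with
    | _ f =>
      refine Germ.coe_eq.2 ?_
      filter_upwards [ae_mul_left h s⁻¹] with x hx
      rw [hx]

end Twist

/-! ### The connected case -/

section Connected

/-- Two homomorphisms on a connected group that agree near `1` are equal. -/
theorem MonoidHom.eq_of_eventuallyEq {H A : Type*} [Group H] [TopologicalSpace H]
    [IsTopologicalGroup H] [PreconnectedSpace H] [Group A] {σ τ : H →* A}
    (h : ∀ᶠ s in 𝓝 1, σ s = τ s) : σ = τ := by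
  have h1 : IsOpen (σ.eqLocus τ : Set H) := Subgroup.isOpen_of_mem_nhds _ h
  have h2 : (σ.eqLocus τ : Set H) = Set.univ :=
    IsClopen.eq_univ ⟨Subgroup.isClosed_of_isOpen _ h1, h1⟩ ⟨1, one_mem _⟩
  exact MonoidHom.ext fun s => (h2 ▸ Set.mem_univ s : s ∈ (σ.eqLocus τ : Set H))

variable {G : Type*} [Group G] [TopologicalSpace G] [IsTopologicalGroup G]
  [SecondCountableTopology G] [MeasurableSpace G] [BorelSpace G]
  {μ : Measure G} [IsProbabilityMeasure μ] [μ.InnerRegular] [μ.IsMulRightInvariant]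
  [μ.IsMulLeftInvariant] {Γ Λ : Subgroup G} {Δ : Type*} [Group Δ] [Countable Δ] [MeasurableSpace Δ]
  [DiscreteMeasurableSpace Δ]
  {H : Type*} [Group H] [TopologicalSpace H] [IsTopologicalGroup H]
  [SimplyConnectedSpace H] [LocallyPathConnectedSpace H]

/-- On a simply connected group the canonical intertwiners over small elements extend to a
multiplicative family of intertwiners. -/
theorem exists_intertwiner_hom {φ : Λ → G → Δ} (hΛ : Dense (Λ : Set G))
    (hnear : nearTrivial μ φ (1 / 8) ∈ 𝓝 1) {p : H →* G} (hp : Continuous p) :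
    ∃ (σ : H →* Equiv.Perm (Germ (ae μ) Δ)) (F : H → G → Δ),
      (∀ s, IsIntertwiner μ φ (p s) (F s)) ∧
      (∀ s, σ s = twistedTranslation μ (p s) (F s)) ∧
      ∀ᶠ s in 𝓝 1, σ s = twistedTranslation μ (p s) (nearIntertwiner μ φ (p s)) := by
  have hU : p ⁻¹' nearTrivial μ φ (1 / 8) ∈ 𝓝 1 :=
    hp.continuousAt.preimage_mem_nhds (by rwa [map_one])
  obtain ⟨σ, hσ⟩ := exists_monoidHom_eventuallyEq hU
    (f := fun s => twistedTranslation μ (p s) (nearIntertwiner μ φ (p s))) fun s hs t ht hst => by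
      have hst' : p s * p t ∈ nearTrivial μ φ (1 / 8) := by rw [← map_mul]; exact hst
      rw [twistedTranslation_mul, map_mul, twistedTranslation_eq_iff]
      exact nearIntertwiner_mul hΛ hs ht hst'
  let K : Subgroup H :=
    { carrier := {s | ∃ ψ, IsIntertwiner μ φ (p s) ψ ∧ σ s = twistedTranslation μ (p s) ψ}
      one_mem' := by
        refine ⟨nearIntertwiner μ φ (p 1), ?_, hσ.self_of_nhds⟩
        have h1 : p 1 ∈ nearTrivial μ φ (1 / 8) := (mem_of_mem_nhds hU : (1 : H) ∈ p ⁻¹' _)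
        exact (isIntertwiner_nearIntertwiner h1).1
      mul_mem' := by
        rintro s t ⟨ψ, h1, h2⟩ ⟨ψ', h1', h2'⟩
        refine ⟨_, by rw [map_mul]; exact h1.mul h1', ?_⟩
        rw [map_mul, h2, h2', twistedTranslation_mul, map_mul]
      inv_mem' := by
        rintro s ⟨ψ, h1, h2⟩
        refine ⟨_, by rw [map_inv]; exact h1.inv, ?_⟩
        rw [map_inv, h2, twistedTranslation_inv, map_inv] }
  have hKo : IsOpen (K : Set H) := by
    refine Subgroup.isOpen_of_mem_nhds K (g := 1) ?_
    filter_upwards [hσ, hU] with s h1 h2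
    exact ⟨_, (isIntertwiner_nearIntertwiner h2).1, h1⟩
  have hK : (K : Set H) = Set.univ :=
    IsClopen.eq_univ ⟨Subgroup.isClosed_of_isOpen _ hKo, hKo⟩ ⟨1, one_mem _⟩
  have hall : ∀ s, ∃ ψ, IsIntertwiner μ φ (p s) ψ ∧ σ s = twistedTranslation μ (p s) ψ :=
    fun s => (hK ▸ Set.mem_univ s : s ∈ (K : Set H))
  choose F hF hσF using hall
  exact ⟨σ, F, hF, hσF, hσ⟩

/-- The connected case: the multiplicative family of intertwiners over the simply connected cover
is equivariant under `Γ`, because conjugation by an element of `Γ` gives two homomorphisms that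
agree near `1`. -/
theorem cohomologousToHom_of_simplyConnected [LocallyCompactSpace H] [SecondCountableTopology H]
    [MeasurableSpace H] [BorelSpace H] {ν : Measure H} [ν.IsHaarMeasure]
    (hΛ : Dense (Λ : Set G)) {w : Γ × Λ → G → Δ} (hw : IsMeasurableCocycle μ w)
    (hnear : ∀ ε : ℝ, 0 < ε → nearTrivial μ (rightPart w) ε ∈ 𝓝 1)
    {p : H →* G} (hp : Continuous p) (hsurj : Function.Surjective p) :
    CohomologousToHom ν (liftCocycle w p) := by
  obtain ⟨σ, F, hF, hσF, hσ⟩ := exists_intertwiner_hom hΛ (hnear (1 / 8) (by norm_num)) hp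
  have hqmp : Measure.QuasiMeasurePreserving p ν μ :=
    quasiMeasurePreserving_of_range_ne_zero hp.measurable (by simp [hsurj.range_eq])
  have hp1 : Tendsto p (𝓝 1) (𝓝 1) := by simpa using hp.tendsto 1
  refine cohomologousToHom_of_equivariant hw hqmp (fun s => (hF s).measurable) (fun s t => ?_)
    (fun ε hε => ?_) (hw.equivariant_of_leftPart hF fun g s => ?_)
  · have h := map_mul σ s t
    rw [hσF, hσF, hσF, twistedTranslation_mul, map_mul, twistedTranslation_eq_iff] at h
    exact h
  · filter_upwards [hσ, hp1.eventually (eventually_nearIntertwiner hΛ hnear hε)] with s h1 h2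
    rw [hσF, twistedTranslation_eq_iff] at h1
    refine le_of_eq_of_le (measureReal_congr ?_) h2
    filter_upwards [h1] with x hx
    exact congrArg (· ≠ (1 : Δ)) hx
  · set g' := p.subgroupComap Γ g
    set T := twistedTranslation μ (p g) (leftPart w g')
    have hconj : Tendsto (fun s => (g : H) * s * (g : H)⁻¹) (𝓝 1) (𝓝 1) := by
      have : Continuous fun s : H => (g : H) * s * (g : H)⁻¹ := by fun_prop
      simpa using this.tendsto 1
    have hsmall := hp1.eventually (hnear (1 / 8) (by norm_num))
    have h1 : σ.comp (MulAut.conj (g : H)).toMonoidHom = (MulAut.conj T).toMonoidHom.comp σ := by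
      refine MonoidHom.eq_of_eventuallyEq ?_
      filter_upwards [hσ, hconj.eventually hσ, hsmall, hconj.eventually hsmall,
        hp1.eventually (eventually_measureReal_mul_left_ne (μ := μ) (hw.measurable (g', 1))
          (ε := 1 / 8) (by norm_num))] with s h1 h2 h3 h4 h5
      have h6 : p (g * s * (g : H)⁻¹) = p g * p s * (p g)⁻¹ := by simp
      change σ (g * s * (g : H)⁻¹) = T * σ s * T⁻¹
      rw [h6] at h4
      rw [h1, h2, eq_mul_inv_iff_mul_eq, twistedTranslation_mul, twistedTranslation_mul, h6,
        inv_mul_cancel_right, eq_comm, twistedTranslation_eq_iff]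
      exact leftPart_mul_nearIntertwiner hΛ hw g' h3 h4 h5
    have h2 : σ (g * s * (g : H)⁻¹) = T * σ s * T⁻¹ := DFunLike.congr_fun h1 s
    have h6 : p (g * s * (g : H)⁻¹) = p g * p s * (p g)⁻¹ := by simp
    rw [hσF, hσF, eq_mul_inv_iff_mul_eq, twistedTranslation_mul, twistedTranslation_mul, h6,
      inv_mul_cancel_right, eq_comm, twistedTranslation_eq_iff] at h2
    exact h2

end Connected

/-! ### Superrigidity of left-right translation actions -/

theorem theoremA {G : Type*} [Group G] [TopologicalSpace G] [IsTopologicalGroup G]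
    [CompactSpace G] [PolishSpace G] [MeasurableSpace G] [BorelSpace G]
    (μ : Measure G) [μ.IsHaarMeasure] [IsProbabilityMeasure μ]
    (Γ Λ : Subgroup G) [Countable Γ] [Countable Λ]
    (hΓ : Dense (Γ : Set G)) (hΛ : Dense (Λ : Set G))
    (hΓ_erg : StronglyErgodic Γ μ) (hΛ_fg : Λ.FG)
    {Δ : Type*} [Group Δ] [Countable Δ] [MeasurableSpace Δ] [DiscreteMeasurableSpace Δ]
    (w : Γ × Λ → G → Δ) (hw : IsMeasurableCocycle μ w) :
    (TotallyDisconnectedSpace G → Γ.FG →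
      ∃ G₀ : Subgroup G, IsOpen (G₀ : Set G) ∧
        CohomologousToHom (μ.comap ((↑) : G₀ → G)) (restrictCocycle w G₀)) ∧
    (ConnectedSpace G →
      ∀ (G' : Type*) [Group G'] [TopologicalSpace G'] [IsTopologicalGroup G']
        [LocallyCompactSpace G'] [T2Space G'] [SimplyConnectedSpace G']
        [MeasurableSpace G'] [BorelSpace G']
        (μ' : Measure G') [μ'.IsHaarMeasure]
        (p : G' →* G), Continuous p → Function.Surjective p → DiscreteTopology p.ker →
        CohomologousToHom μ' (liftCocycle w p)) := by
  have : μ.IsMulRightInvariant := isMulRightInvariant_of_compactSpace μ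
  have hclose := fun (ε : ℝ) (hε : 0 < ε) => exists_nhds_uniformly_close hΓ_erg hΛ_fg
    (v := leftPart w) (φ := rightPart w) (fun g => hw.measurable _) (fun k => hw.measurable _)
    (fun g => (hw.isIntertwiner_leftPart g).map_mul) hw.rightPart_mul hε
  have hnear : ∀ ε : ℝ, 0 < ε → nearTrivial μ (rightPart w) ε ∈ 𝓝 1 := fun ε hε =>
    nearTrivial_mem_nhds hΛ (fun k => hw.measurable _) hw.rightPart_mul hclose hε
  refine ⟨fun hG hΓ_fg => exists_open_subgroup_cohomologousToHom hΛ hΓ_fg hw hnear, ?_⟩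
  intro _ G' _ _ _ _ _ _ _ _ μ' _ p hp hsurj hker
  have := sigmaCompactSpace_of_connected (H := G')
  have := secondCountableTopology_of_isCountablyGenerated
    (isCountablyGenerated_nhds_one_of_discrete_ker hp hker)
  have := locallyPathConnectedSpace_of_pathConnected (H := G')
  exact cohomologousToHom_of_simplyConnected hΛ hw hnear hp hsurj
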